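/- Let $G=\mathrm{SU}(3)$ and let $K=\mathrm S(\mathrm U(2)\times \mathrm U(1))\subset G$ be the subgroup of block diagonal elements $k=\mathrm{diag}(A,a)$ with $A\in \mathrm U(2)$, $a=(\det A)^{-1}$. For $g\in G$ let $A(g)$ be its left upper $2\times2$ block; then $k\mapsto A(k)$ identifies $K$ with $\mathrm U(2)$. Put $\mathcal A=\{g\in G:\det A(g)\neq0\}$. Let $G$ act on $P_2(\mathbb C)$, identify $(x,y)\in\mathbb C^2$ with the point $(x:y:1)$, and let $p(g)=g\cdot(0:0:1)$, so that $p$ maps $\mathcal A$ onto $\mathbb C^2$. For $n\in\mathbb Z$, $\ell\in\mathbb Z_{\ge0}$ let $\pi=\pi_{n,\ell}$ be the representation $\pi(A)=(\det A)^nA^\ell$ of $\mathrm{GL}(2,\mathbb C)$ on $V_\pi$, where $A^\ell$ is the $\ell$-th symmetric power of $A$. Write $\pi(k)=\pi(A(k))$ for $k\in K$, and let $\dot\pi:\mathfrak{gl}(2,\mathbb C)\to\mathrm{End}(V_\pi)$ be the derivative of $\pi$. For $g\in\mathcal A$ put $\Phi_\pi(g)=\pi(A(g))$. Elements of $\mathfrak{sl}(3,\mathbb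 C)$ act on $\mathrm{End}(V_\pi)$-valued functions on $\mathcal A$ as (complexified) left-invariant vector fields. With the matrix units $E_{ij}$ let $X_\alpha=E_{12}$, $X_\beta=E_{23}$, $X_\gamma=E_{13}$, $X_{-\alpha}=E_{21}$, $X_{-\beta}=E_{32}$, $X_{-\gamma}=E_{31}$, $H_\alpha=E_{11}-E_{22}$, $H_\gamma=E_{11}-E_{33}$, $Z=\mathrm{diag}(1,1,-2)$, and $$\Delta_{2}=\Delta_{2,K}-4X_{-\beta}X_\beta-4X_{-\gamma}X_\gamma,\qquad \Delta_{2,K}=-H_\alpha^2-\tfrac13Z^2-2H_\alpha-2Z-4X_{-\alpha}X_\alpha .$$ Block diagonal elements of $\mathfrak{sl}(3,\mathbb C)$ are identified with their left upper $2\times2$ block when $\dot\pi$ is applied to them, and $\dot\pi(\Delta_{2,K})=-\dot\pi(H_\alpha)^2-\tfrac13\dot\pi(Z)^2-2\dot\pi(H_\alpha)-2\dot\pi(Z)-4\dot\pi(X_{-\alpha})\dot\pi(X_\alpha)$. A function $H$ on $\mathbb C^2$ is also regarded as the function $H\circ p$ on $\mathcal A$. Let $$D(H)=-4(X_{-\beta}X_\beta+X_{-\gamma}X_\gamma)(H)-4\bigl(X_\beta(H)\,X_{-\beta}(\Phi_\pi)\Phi_\pi^{-1}+X_\gamma(H)\,X_{-\gamma}(\Phi_\pi)\Phi_\pi^{-1}\bigr).$$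 **(a)** For every $C^\infty$ function $H:\mathbb C^2\to\mathrm{End}(V_\pi)$, on $\mathcal A$, $$\Delta_2(H\Phi_\pi)=H\Phi_\pi\,\dot\pi(\Delta_{2,K})+D(H)\Phi_\pi .$$ **(b)** Let $H:\mathbb C^2\to\mathrm{End}(V_\pi)$ be $C^\infty$ with $H(kz)=\pi(k)H(z)\pi(k)^{-1}$ for all $k\in K$, $z\in\mathbb C^2$, and let $\tilde H(r)=H(r,0)$. Then for every $r>0$ the value of $D(H)$ at any $g\in\mathcal A$ with $p(g)=(r,0)$ is $(\tilde D\tilde H)(r)$, where $$\begin{aligned}\tilde D(\tilde H)(r)={}&(1+r^2)^2\frac{d^2\tilde H}{dr^2}+\frac{1+r^2}{r}\bigl(3+r^2-2r^2\dot\pi(H_\gamma)\bigr)\frac{d\tilde H}{dr}\\&+\frac{1+r^2}{r^2}\bigl(\dot\pi(J)^2\tilde H(r)+\tilde H(r)\dot\pi(J)^2-2\dot\pi(J)\tilde H(r)\dot\pi(J)\bigr)\\&-\frac{1+r^2}{r^2}\bigl(\dot\pi(T)^2\tilde H(r)+\tilde H(r)\dot\pi(T)^2-2\dot\pi(T)\tilde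 H(r)\dot\pi(T)\bigr)\\&-4\dot\pi(X_{-\alpha})\tilde H(r)\dot\pi(X_\alpha)+4\tilde H(r)\dot\pi(X_{-\alpha})\dot\pi(X_\alpha),\end{aligned}$$ with $J=\begin{pmatrix}0&1\\-1&0\end{pmatrix}$, $T=\begin{pmatrix}0&1\\1&0\end{pmatrix}$. **(c)** There is a basis $v_0,\dots,v_\ell$ of $V_\pi$ with $\dot\pi(H_\alpha)v_i=(\ell-2i)v_i$, $\dot\pi(X_\alpha)v_i=(\ell-i+1)v_{i-1}$, $\dot\pi(X_{-\alpha})v_i=(i+1)v_{i+1}$, $\dot\pi(Z)v_i=(2n+\ell)v_i$ (where $v_{-1}=v_{\ell+1}=0$). Fix any such basis. For every $H$ as in (b) there are $C^\infty$ functions $h_0,\dots,h_\ell:(0,\infty)\to\mathbb C$ with $\tilde H(r)v_i=h_i(r)v_i$ for all $r>0$ and all $i$. Moreover, for every function $\tilde H:(0,\infty)\to\mathrm{End}(V_\pi)$ of the form $\tilde H(r)v_i=h_i(r)v_i$ with $h_0,\dots,h_\ell$ of class $C^2$ one has $(\tilde D\tilde H)(r)v_i=L_i(r)v_i$ for all $r>0$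 and all $i$, where $$\begin{aligned}L_i={}&(1+r^2)^2h_i''+\frac{1+r^2}{r}\bigl(3+r^2-2r^2(n+\ell-i)\bigr)h_i'-4i(\ell-i+1)(h_{i-1}-h_i)\\&+\frac{4(1+r^2)}{r^2}\bigl((i+1)(\ell-i)(h_{i+1}-h_i)+i(\ell-i+1)(h_{i-1}-h_i)\bigr)\end{aligned}$$ (with $h_{-1}=h_{\ell+1}=0$). Consequently, for $\lambda\in\mathbb C$, $\tilde D\tilde H=\lambda\tilde H$ on $(0,\infty)$ if and only if $L_i=\lambda h_i$ on $(0,\infty)$ for all $i=0,\dots,\ell$. -/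

import Mathlib

open scoped Matrix ContDiff

/- Matrix algebras are normed algebras for the operator norm coming from the sup norm. The spaces are
finite dimensional, so smoothness and derivatives do not depend on this choice. -/
attribute [local instance] Matrix.linftyOpNormedRing Matrix.linftyOpNormedAlgebra

noncomputable section

namespace SU3

/-- `G = SU(3)`. -/
abbrev G : Type := Matrix.specialUnitaryGroup (Fin 3) ℂ

/-- Endomorphisms of `V_π`, the space of the `ℓ`-th symmetric power of `ℂ²`, as matrices in the
basis `e₁^(ℓ-i) e₂^i`, `0 ≤ i ≤ ℓ`. -/
abbrev EndV (ℓ : ℕ) : Type := Matrix (Fin (ℓ + 1)) (Fin (ℓ + 1)) ℂ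

/-! ### The Lie algebra of `SU(3)` and its complexification -/

/-- `𝔤 = 𝔰𝔲(3)`: skew-Hermitian matrices of trace zero. -/
def su3 : Submodule ℝ (Matrix (Fin 3) (Fin 3) ℂ) where
  carrier := {Y | Yᴴ = -Y ∧ Y.trace = 0}
  add_mem' := by
    rintro a b ⟨ha, ha'⟩ ⟨hb, hb'⟩
    refine ⟨?_, ?_⟩
    · rw [Matrix.conjTranspose_add, ha, hb]; abel
    · rw [Matrix.trace_add, ha', hb', add_zero]
  zero_mem' := by simp
  smul_mem' := by
    rintro c a ⟨ha, ha'⟩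
    refine ⟨?_, ?_⟩
    · rw [Matrix.conjTranspose_smul, ha]; simp
    · rw [Matrix.trace_smul, ha', smul_zero]

theorem exp_mem_specialUnitary {Y : Matrix (Fin 3) (Fin 3) ℂ} (hY : Y ∈ su3) :
    NormedSpace.exp Y ∈ Matrix.specialUnitaryGroup (Fin 3) ℂ := by
  obtain ⟨h1, h2⟩ := hY
  have hA : (Complex.I • Y).IsHermitian := by
    rw [Matrix.IsHermitian, Matrix.conjTranspose_smul, h1]; simp
  rw [Matrix.mem_specialUnitaryGroup_iff]
  refine ⟨?_, ?_⟩
  · rw [Matrix.mem_unitaryGroup_iff, Matrix.star_eq_conjTranspose, ← Matrix.exp_conjTranspose, h1,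
      ← Matrix.exp_add_of_commute _ _ ((Commute.refl Y).neg_right), add_neg_cancel,
      NormedSpace.exp_zero]
  · set U := hA.eigenvectorUnitary with hU
    set d : Fin 3 → ℂ := fun i => -Complex.I * (hA.eigenvalues i : ℂ) with hd
    have hUU : (U : Matrix (Fin 3) (Fin 3) ℂ) * star (U : Matrix (Fin 3) (Fin 3) ℂ) = 1 :=
      Matrix.mem_unitaryGroup_iff.1 U.2
    have hinv : (U : Matrix (Fin 3) (Fin 3) ℂ)⁻¹ = star (U : Matrix (Fin 3) (Fin 3) ℂ) :=
      Matrix.inv_eq_right_inv hUU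
    have hunit : IsUnit (U : Matrix (Fin 3) (Fin 3) ℂ) :=
      IsUnit.of_mul_eq_one _ hUU
    have hY : Y = (U : Matrix (Fin 3) (Fin 3) ℂ) * Matrix.diagonal d
        * (U : Matrix (Fin 3) (Fin 3) ℂ)⁻¹ := by
      have h := hA.spectral_theorem
      rw [Unitary.conjStarAlgAut_apply] at h
      have h' : Y = (-Complex.I) • (Complex.I • Y) := by
        rw [smul_smul]; simp
      rw [h', h, hinv, ← Matrix.smul_mul, ← Matrix.mul_smul, ← Matrix.diagonal_smul]
      rfl
    have hdet : IsUnit (U : Matrix (Fin 3) (Fin 3) ℂ).det :=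
      (Matrix.isUnit_iff_isUnit_det _).1 hunit
    have htr : ∑ i, d i = 0 := by
      rw [← h2, hY, Matrix.trace_mul_comm, ← mul_assoc, Matrix.nonsing_inv_mul _ hdet, one_mul,
        Matrix.trace_diagonal]
    rw [hY, Matrix.exp_conj _ _ hunit, Matrix.exp_diagonal, Matrix.det_conj hunit,
      Matrix.det_diagonal]
    simp only [Pi.coe_exp, ← Complex.exp_eq_exp_ℂ]
    rw [← Complex.exp_sum, htr, Complex.exp_zero]

/-- The exponential map `𝔤 → G`. -/
def expG (Y : su3) : G := ⟨NormedSpace.exp (Y : Matrix (Fin 3) (Fin 3) ℂ),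
  exp_mem_specialUnitary Y.2⟩

/-- The complexification `𝔤_ℂ = 𝔰𝔩(3, ℂ)`. -/
abbrev sl3 : Type := LieAlgebra.SpecialLinear.sl (Fin 3) ℂ

theorem trace_sl3 (X : sl3) : (X : Matrix (Fin 3) (Fin 3) ℂ).trace = 0 := X.2

/-- The `𝔤`-component `X₁` of `X = X₁ + i X₂`, with `X₁, X₂ ∈ 𝔤`. -/
def skewRe (X : sl3) : su3 :=
  ⟨(1 / 2 : ℂ) • ((X : Matrix (Fin 3) (Fin 3) ℂ) - (X : Matrix (Fin 3) (Fin 3) ℂ)ᴴ), by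
    refine ⟨?_, ?_⟩
    · simp [Matrix.conjTranspose_smul, ← smul_neg]
    · simp [Matrix.trace_conjTranspose, trace_sl3 X]⟩

/-- The `𝔤`-component `X₂` of `X = X₁ + i X₂`, with `X₁, X₂ ∈ 𝔤`. -/
def skewIm (X : sl3) : su3 :=
  ⟨(-(Complex.I / 2)) • ((X : Matrix (Fin 3) (Fin 3) ℂ) + (X : Matrix (Fin 3) (Fin 3) ℂ)ᴴ), by
    refine ⟨?_, ?_⟩
    · simp [Matrix.conjTranspose_smul, neg_div, add_comm]
    · simp [Matrix.trace_conjTranspose, trace_sl3 X]⟩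

theorem skewRe_add_skewIm (X : sl3) :
    (X : Matrix (Fin 3) (Fin 3) ℂ) = (skewRe X : Matrix (Fin 3) (Fin 3) ℂ)
      + Complex.I • (skewIm X : Matrix (Fin 3) (Fin 3) ℂ) := by
  ext i j
  simp only [skewRe, skewIm, Matrix.add_apply, Matrix.sub_apply, Matrix.smul_apply, smul_eq_mul]
  linear_combination ((1 / 2) * ((X : Matrix (Fin 3) (Fin 3) ℂ) i j
    + (X : Matrix (Fin 3) (Fin 3) ℂ)ᴴ i j)) * Complex.I_sq

/-- The left-invariant vector field of `Y ∈ 𝔤`: `(Y F)(g) = d/dt|₀ F(g exp tY)`. -/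
def realField {ℓ : ℕ} (Y : su3) (F : G → EndV ℓ) : G → EndV ℓ :=
  fun g => deriv (fun t : ℝ => F (g * expG (t • Y))) 0

/-- The left-invariant complex vector field of `X = X₁ + i X₂ ∈ 𝔤_ℂ`: `X F = X₁ F + i X₂ F`. -/
def field {ℓ : ℕ} (X : sl3) (F : G → EndV ℓ) : G → EndV ℓ :=
  fun g => realField (skewRe X) F g + Complex.I • realField (skewIm X) F g

theorem mem_sl3 {X : Matrix (Fin 3) (Fin 3) ℂ} (h : X.trace = 0) :
    X ∈ LieAlgebra.SpecialLinear.sl (Fin 3) ℂ := h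

def Xα : sl3 := ⟨!![0, 1, 0; 0, 0, 0; 0, 0, 0], mem_sl3 (by simp [Matrix.trace_fin_three])⟩
def Xmα : sl3 := ⟨!![0, 0, 0; 1, 0, 0; 0, 0, 0], mem_sl3 (by simp [Matrix.trace_fin_three])⟩
def Xβ : sl3 := ⟨!![0, 0, 0; 0, 0, 1; 0, 0, 0], mem_sl3 (by simp [Matrix.trace_fin_three])⟩
def Xmβ : sl3 := ⟨!![0, 0, 0; 0, 0, 0; 0, 1, 0], mem_sl3 (by simp [Matrix.trace_fin_three])⟩
def Xγ : sl3 := ⟨!![0, 0, 1; 0, 0, 0; 0, 0, 0], mem_sl3 (by simp [Matrix.trace_fin_three])⟩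
def Xmγ : sl3 := ⟨!![0, 0, 0; 0, 0, 0; 1, 0, 0], mem_sl3 (by simp [Matrix.trace_fin_three])⟩
def Hα : sl3 := ⟨!![1, 0, 0; 0, -1, 0; 0, 0, 0], mem_sl3 (by simp [Matrix.trace_fin_three])⟩
def Hβ : sl3 := ⟨!![0, 0, 0; 0, 1, 0; 0, 0, -1], mem_sl3 (by simp [Matrix.trace_fin_three])⟩
/-- `Z = H_α + 2 H_β = diag(1, 1, -2)`. -/
def Z : sl3 := Hα + (2 : ℂ) • Hβ

/-- The Casimir operator
`Δ₂ = -H_α² - Z²/3 - 2H_α - 2Z - 4X_{-α}X_α - 4X_{-β}X_β - 4X_{-γ}X_γ` of `SU(3)`. -/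
def Δ₂ {ℓ : ℕ} (F : G → EndV ℓ) : G → EndV ℓ := fun g =>
  -field Hα (field Hα F) g - (1 / 3 : ℂ) • field Z (field Z F) g
    - (2 : ℂ) • field Hα F g - (2 : ℂ) • field Z F g
    - (4 : ℂ) • field Xmα (field Xα F) g
    - (4 : ℂ) • field Xmβ (field Xβ F) g
    - (4 : ℂ) • field Xmγ (field Xγ F) g

/-! ### The representations `π_{n,ℓ}` -/

/-- The `ℓ`-th symmetric power `A^ℓ` of a `2 × 2` matrix `A`, in the basis `e₁^(ℓ-i) e₂^i`: the
`j`-th column holds the coordinates of `(A e₁)^(ℓ-j) (A e₂)^j`, where `e₁, e₂` are the two variables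
of a polynomial ring. -/
def symPow (ℓ : ℕ) (A : Matrix (Fin 2) (Fin 2) ℂ) : EndV ℓ :=
  Matrix.of fun i j => MvPolynomial.coeff
    (Finsupp.single (0 : Fin 2) (ℓ - (i : ℕ)) + Finsupp.single (1 : Fin 2) (i : ℕ))
    ((MvPolynomial.C (A 0 0) * MvPolynomial.X 0
        + MvPolynomial.C (A 1 0) * MvPolynomial.X 1) ^ (ℓ - (j : ℕ))
      * (MvPolynomial.C (A 0 1) * MvPolynomial.X 0
        + MvPolynomial.C (A 1 1) * MvPolynomial.X 1) ^ (j : ℕ))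

/-- `π_{n,ℓ}(A) = (det A)^n A^ℓ` (used at `A` with `det A ≠ 0`). -/
def rep (n : ℤ) (ℓ : ℕ) (A : Matrix (Fin 2) (Fin 2) ℂ) : EndV ℓ :=
  A.det ^ n • symPow ℓ A

/-- The derivative `π̇ : 𝔤𝔩(2, ℂ) → End(V_π)` of the holomorphic representation `π_{n,ℓ}` of
`GL(2, ℂ)`: `π̇(X) = d/dt|₀ π(exp tX)`. -/
def drep (n : ℤ) (ℓ : ℕ) (X : Matrix (Fin 2) (Fin 2) ℂ) : EndV ℓ :=
  deriv (fun t : ℝ => rep n ℓ (NormedSpace.exp (t • X))) 0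

/-- The left upper `2 × 2` block `A(g)`. -/
def block (g : Matrix (Fin 3) (Fin 3) ℂ) : Matrix (Fin 2) (Fin 2) ℂ :=
  !![g 0 0, g 0 1; g 1 0, g 1 1]

/-- `K = S(U(2) × U(1))`, the block diagonal elements of `SU(3)`; via `k ↦ A(k)` it is `U(2)`. -/
def K : Set G := {k | k.1 0 2 = 0 ∧ k.1 1 2 = 0 ∧ k.1 2 0 = 0 ∧ k.1 2 1 = 0}

/-- The open set `𝒜 = {g ∈ G : det A(g) ≠ 0}`. -/
def 𝒜 : Set G := {g | (block g.1).det ≠ 0}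

/-- `Φ_π(g) = π(A(g))`. -/
def Φ (n : ℤ) (ℓ : ℕ) : G → EndV ℓ := fun g => rep n ℓ (block g.1)

/-- The element `π̇(Δ_{2,K})`, where `Δ_{2,K} = -H_α² - Z²/3 - 2H_α - 2Z - 4X_{-α}X_α`; elements of
`𝔨_ℂ` are identified with elements of `𝔤𝔩(2, ℂ)` through their left upper block. -/
def drepΔ₂K (n : ℤ) (ℓ : ℕ) : EndV ℓ :=
  -(drep n ℓ (block Hα.1)) ^ 2 - (1 / 3 : ℂ) • (drep n ℓ (block Z.1)) ^ 2
    - (2 : ℂ) • drep n ℓ (block Hα.1) - (2 : ℂ) • drep n ℓ (block Z.1)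
    - (4 : ℂ) • (drep n ℓ (block Xmα.1) * drep n ℓ (block Xα.1))

/-! ### The affine plane in the projective plane and the operator `D` -/

/-- The action of `g` on the projective plane in the affine chart `(x, y) ↔ (x : y : 1)`. -/
def act (g : G) (z : ℂ × ℂ) : ℂ × ℂ :=
  ((g.1 0 0 * z.1 + g.1 0 1 * z.2 + g.1 0 2) / (g.1 2 0 * z.1 + g.1 2 1 * z.2 + g.1 2 2),
   (g.1 1 0 * z.1 + g.1 1 1 * z.2 + g.1 1 2) / (g.1 2 0 * z.1 + g.1 2 1 * z.2 + g.1 2 2))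

/-- The projection `p(g) = g · (0 : 0 : 1)`, which maps `𝒜` onto the affine plane. -/
def p (g : G) : ℂ × ℂ := act g (0, 0)

/-- `H(k z) = π(k) H(z) π(k)⁻¹` for all `k ∈ K` and all `z` in the affine plane. -/
def Equivariant (n : ℤ) {ℓ : ℕ} (H : ℂ × ℂ → EndV ℓ) : Prop :=
  ∀ k ∈ K, ∀ z : ℂ × ℂ,
    H (act k z) = rep n ℓ (block k.1) * H z * (rep n ℓ (block k.1))⁻¹

/-- `D₁(F) = -4 (X_{-β}X_β + X_{-γ}X_γ)(F)`. -/
def D₁ {ℓ : ℕ} (F : G → EndV ℓ) : G → EndV ℓ := fun g =>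
  (-4 : ℂ) • (field Xmβ (field Xβ F) g + field Xmγ (field Xγ F) g)

/-- `D₂(F) = -4 (X_β(F) X_{-β}(Φ_π) Φ_π⁻¹ + X_γ(F) X_{-γ}(Φ_π) Φ_π⁻¹)`. -/
def D₂ (n : ℤ) {ℓ : ℕ} (F : G → EndV ℓ) : G → EndV ℓ := fun g =>
  (-4 : ℂ) • (field Xβ F g * field Xmβ (Φ n ℓ) g * (Φ n ℓ g)⁻¹
    + field Xγ F g * field Xmγ (Φ n ℓ) g * (Φ n ℓ g)⁻¹)

/-- `D = D₁ + D₂`, an operator on functions on `𝒜`. -/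
def D (n : ℤ) {ℓ : ℕ} (F : G → EndV ℓ) : G → EndV ℓ := fun g => D₁ F g + D₂ n F g

/-! ### The radial operator and the scalar system -/

/-- The restriction `H̃(r) = H(r, 0)`. -/
def radial {ℓ : ℕ} (H : ℂ × ℂ → EndV ℓ) : ℝ → EndV ℓ := fun r => H ((r : ℂ), 0)

/-- The ordinary differential operator `D̃`. -/
def Dtilde (n : ℤ) {ℓ : ℕ} (F : ℝ → EndV ℓ) (r : ℝ) : EndV ℓ :=
  let J := drep n ℓ !![0, 1; -1, 0]
  let T := drep n ℓ !![0, 1; 1, 0]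
  let dHγ := drep n ℓ !![1, 0; 0, 0]
  let dXα := drep n ℓ !![0, 1; 0, 0]
  let dXmα := drep n ℓ !![0, 0; 1, 0]
  ((1 + r ^ 2) ^ 2) • deriv (deriv F) r
    + ((1 + r ^ 2) / r) • (((3 + r ^ 2) • (1 : EndV ℓ) - (2 * r ^ 2) • dHγ) * deriv F r)
    + ((1 + r ^ 2) / r ^ 2) • (J ^ 2 * F r + F r * J ^ 2 - (2 : ℝ) • (J * F r * J))
    - ((1 + r ^ 2) / r ^ 2) • (T ^ 2 * F r + F r * T ^ 2 - (2 : ℝ) • (T * F r * T))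
    - (4 : ℝ) • (dXmα * F r * dXα) + (4 : ℝ) • (F r * dXmα * dXα)

/-- The extension by zero of a finite sequence `f₀, …, f_ℓ` to all integer indices, so that
`f₋₁ = f_{ℓ+1} = 0`. -/
def ext0 {ℓ : ℕ} {E : Type} [Zero E] (f : Fin (ℓ + 1) → E) (k : ℤ) : E :=
  if hk : 0 ≤ k ∧ k ≤ ℓ then f ⟨k.toNat, by omega⟩ else 0

/-- `v₀, …, v_ℓ` satisfies `π̇(H_α) v_i = (ℓ-2i) v_i`, `π̇(X_α) v_i = (ℓ-i+1) v_{i-1}`,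
`π̇(X_{-α}) v_i = (i+1) v_{i+1}` and `π̇(Z) v_i = (2n+ℓ) v_i`, with `v₋₁ = v_{ℓ+1} = 0`. -/
def IsWeightBasis (n : ℤ) {ℓ : ℕ}
    (v : Module.Basis (Fin (ℓ + 1)) ℂ (Fin (ℓ + 1) → ℂ)) : Prop :=
  ∀ i : Fin (ℓ + 1),
    drep n ℓ !![1, 0; 0, -1] *ᵥ v i = ((ℓ : ℂ) - 2 * (i : ℕ)) • v i ∧
    drep n ℓ !![0, 1; 0, 0] *ᵥ v i = ((ℓ : ℂ) - (i : ℕ) + 1) • ext0 v ((i : ℕ) - 1 : ℤ) ∧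
    drep n ℓ !![0, 0; 1, 0] *ᵥ v i = (((i : ℕ) : ℂ) + 1) • ext0 v ((i : ℕ) + 1 : ℤ) ∧
    drep n ℓ !![1, 0; 0, 1] *ᵥ v i = (2 * (n : ℂ) + ℓ) • v i

/-- The left-hand side of the `i`-th equation of the system, for scalar functions `h₀, …, h_ℓ`. -/
def systemLHS (n : ℤ) {ℓ : ℕ} (h : Fin (ℓ + 1) → ℝ → ℂ) (i : Fin (ℓ + 1)) (r : ℝ) : ℂ :=
  let hi := h i r
  let hprev := ext0 h ((i : ℕ) - 1 : ℤ) r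
  let hnext := ext0 h ((i : ℕ) + 1 : ℤ) r
  let a : ℂ := ((i : ℕ) : ℂ) * ((ℓ : ℂ) - (i : ℕ) + 1)
  let b : ℂ := (((i : ℕ) : ℂ) + 1) * ((ℓ : ℂ) - (i : ℕ))
  (1 + (r : ℂ) ^ 2) ^ 2 * deriv (deriv (h i)) r
    + (1 + (r : ℂ) ^ 2) / r
        * (3 + (r : ℂ) ^ 2 - 2 * (r : ℂ) ^ 2 * ((n : ℂ) + ℓ - (i : ℕ))) * deriv (h i) r
    - 4 * a * (hprev - hi)
    + 4 * (1 + (r : ℂ) ^ 2) / (r : ℂ) ^ 2 * (b * (hnext - hi) + a * (hprev - hi))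

end SU3

end

/-!
All functions on `𝒜` that occur are restrictions of functions of the matrix entries: `Φ_π` of a
holomorphic function, and `H ∘ p` of `H` composed with the holomorphic map
`M ↦ (M₀₂ / M₂₂, M₁₂ / M₂₂)`. A complexified left-invariant field `X` therefore acts on `Φ_π` through
the complex differential of `π`, and on functions of `p(g)` the fields `X_β`, `X_γ` produce the
Wirtinger derivative `∂H` in the directions `dp(g E₂₃)`, `dp(g E₁₃)` (`slope`).

The formula for `Δ₂(H Φ_π)` is the product rule: `𝔨_ℂ` kills `H ∘ p` and acts on `Φ_π` by right
multiplication with `π̇`, while `X_β` and `X_γ` kill `Φ_π`, whose arguments lie in the first two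
columns of `g`.

For the radial part, `-4 X_{-β} X_β (H ∘ p)` and `-4 X_{-γ} X_γ (H ∘ p)` are real Hessians of `H`
summed over the complex lines spanned by the two slopes (`field_field_comp_p`). At `p(g) = (r, 0)`
unitarity of `g` gives the slopes the orthogonality relations that turn the sum into
`(1 + r²)²` and `(1 + r²)` times the Laplacians in the two coordinates (`D₁_of_p_eq`), and it also
evaluates the first-order part (`D₂_of_p_eq`). Equivariance under `K` becomes the identity
`dH(z)(Yz) = [π̇(Y), H(z)]` (`dirDeriv_of_equivariant`); differentiating it once more
(`hess_of_dirDeriv_eq`) expresses every derivative of `H` transversal to the first axis through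
`H̃`, `H̃'` and commutators with `π̇(J)`, `π̇(T)`.

The stabilizer of `(r, 0)` in `K`, together with the scalars, has all diagonal matrices in its
complexified Lie algebra, so `H̃(r)` commutes with `π̇(H_α)`, whose spectrum is simple. Hence `H̃` is
diagonal in every weight basis (`mulVec_eq_of_commute`). On diagonal functions `D̃` is evaluated
directly: `J² - T²` contributes only the products `X_α X_{-α}` and `X_{-α} X_α` (`Dtilde_eq`).
-/

noncomputable section

namespace SU3

/-! ### Derivatives of matrix-valued functions -/

theorem eq_sum_smul_single {n : Type*} [Fintype n] [DecidableEq n] (A : Matrix n n ℂ) :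
    A = ∑ i, ∑ j, A i j • Matrix.single i j (1 : ℂ) := by
  conv_lhs => rw [Matrix.matrix_eq_sum_single A]
  simp

theorem hasDerivAt_matrix {n : Type*} [Fintype n] [DecidableEq n]
    {f : ℝ → Matrix n n ℂ} {f' : Matrix n n ℂ} {t : ℝ}
    (h : ∀ i j, HasDerivAt (fun s => f s i j) (f' i j) t) : HasDerivAt f f' t := by
  rw [show f = fun s => ∑ i, ∑ j, f s i j • Matrix.single i j (1 : ℂ) from
    funext fun s => eq_sum_smul_single (f s), eq_sum_smul_single f']
  exact HasDerivAt.fun_sum fun i _ => HasDerivAt.fun_sum fun j _ => (h i j).smul_const _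

theorem differentiableAt_matrix {n E : Type*} [Fintype n] [DecidableEq n]
    [NormedAddCommGroup E] [NormedSpace ℂ E] {f : E → Matrix n n ℂ} {x : E}
    (h : ∀ i j, DifferentiableAt ℂ (fun y => f y i j) x) : DifferentiableAt ℂ f x := by
  rw [show f = fun s => ∑ i, ∑ j, f s i j • Matrix.single i j (1 : ℂ) from
    funext fun s => eq_sum_smul_single (f s)]
  exact DifferentiableAt.fun_sum fun i _ => DifferentiableAt.fun_sum fun j _ =>
    (h i j).smul_const _

/-- The entry `(i, j)` as a continuous linear functional. -/
def entryCLM {n : Type*} [Fintype n] [DecidableEq n] (i j : n) : Matrix n n ℂ →L[ℂ] ℂ :=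
  LinearMap.toContinuousLinearMap (Matrix.entryLinearMap ℂ ℂ i j)

theorem hasDerivAt_entry {n : Type*} [Fintype n] [DecidableEq n]
    {f : ℝ → Matrix n n ℂ} {f' : Matrix n n ℂ} {t : ℝ} (h : HasDerivAt f f' t) (i j : n) :
    HasDerivAt (fun s => f s i j) (f' i j) t :=
  ((entryCLM i j).restrictScalars ℝ).hasFDerivAt.comp_hasDerivAt t h

theorem hasDerivAt_exp_smul {n : Type*} [Fintype n] [DecidableEq n] (X : Matrix n n ℂ) :
    HasDerivAt (fun t : ℝ => NormedSpace.exp (t • X)) X 0 := by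
  have := hasDerivAt_exp_smul_const (𝕂 := ℝ) X (0 : ℝ)
  rw [zero_smul, NormedSpace.exp_zero, one_mul] at this
  exact this

/-- The entries of a one-parameter curve `t ↦ g exp(tY)`, whose velocity at `0` is `gY`. -/
theorem hasDerivAt_curve (g : G) (Y : su3) (i j : Fin 3) :
    HasDerivAt (fun t : ℝ => (g * expG (t • Y)).1 i j) ((g.1 * Y.1) i j) 0 := by
  have h := (hasDerivAt_exp_smul Y.1).const_mul g.1
  exact hasDerivAt_entry h i j

/-! ### Symmetric powers -/

section SymmetricPower

open MvPolynomial

/-- The linear change of variables `X_j ↦ ∑ᵢ A i j X_i`. -/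
def subst (A : Matrix (Fin 2) (Fin 2) ℂ) : MvPolynomial (Fin 2) ℂ →ₐ[ℂ] MvPolynomial (Fin 2) ℂ :=
  aeval fun j => C (A 0 j) * X 0 + C (A 1 j) * X 1

/-- The exponent of the monomial `e₁^(ℓ-i) e₂^i`. -/
def expo (ℓ i : ℕ) : Fin 2 →₀ ℕ := Finsupp.single 0 (ℓ - i) + Finsupp.single 1 i

theorem monomial_expo (ℓ i : ℕ) :
    monomial (expo ℓ i) (1 : ℂ) = X 0 ^ (ℓ - i) * X 1 ^ i := by
  rw [X_pow_eq_monomial, X_pow_eq_monomial, monomial_mul, one_mul, expo]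

theorem expo_inj {ℓ : ℕ} {i j : ℕ} : expo ℓ i = expo ℓ j ↔ i = j := by
  constructor
  · intro h
    have := DFunLike.congr_fun h 1
    simpa [expo] using this
  · rintro rfl; rfl

theorem isHomogeneous_subst_monomial (ℓ : ℕ) (A : Matrix (Fin 2) (Fin 2) ℂ) (j : Fin (ℓ + 1)) :
    (subst A (monomial (expo ℓ j) 1)).IsHomogeneous ℓ := by
  have hlin : ∀ k, (C (A 0 k) * X 0 + C (A 1 k) * X 1 :
      MvPolynomial (Fin 2) ℂ).IsHomogeneous 1 := fun k =>
    (by simpa using (isHomogeneous_C (Fin 2) (A 0 k)).mul (isHomogeneous_X ℂ (0 : Fin 2)) :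
      (C (A 0 k) * X 0 : MvPolynomial (Fin 2) ℂ).IsHomogeneous 1).add
    (by simpa using (isHomogeneous_C (Fin 2) (A 1 k)).mul (isHomogeneous_X ℂ (1 : Fin 2)))
  have h := ((hlin 0).pow (ℓ - j)).mul ((hlin 1).pow j)
  rw [monomial_expo]
  simp only [subst, map_mul, map_pow, aeval_X]
  have hj := j.2
  convert h using 1
  omega

/-- A homogeneous polynomial of degree `ℓ` is the combination of the monomials `e₁^(ℓ-i) e₂^i`. -/
theorem eq_sum_monomial_expo {ℓ : ℕ} {q : MvPolynomial (Fin 2) ℂ} (hq : q.IsHomogeneous ℓ) :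
    q = ∑ i : Fin (ℓ + 1), C (q.coeff (expo ℓ i)) * monomial (expo ℓ i) 1 := by
  ext d
  simp only [coeff_sum, coeff_C_mul, coeff_monomial]
  by_cases hd : d 0 + d 1 = ℓ
  · have : d = expo ℓ (d 1) := by
      ext k
      fin_cases k
      · simp [expo]; omega
      · simp [expo]
    rw [Finset.sum_eq_single (⟨d 1, by omega⟩ : Fin (ℓ + 1))]
    · simp [← this]
    · intro b _ hb
      rw [if_neg, mul_zero]
      intro h
      apply hb
      rw [this] at h
      exact Fin.ext (expo_inj.1 h)
    · simp
  · have h0 : q.coeff d = 0 := by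
      by_contra h
      apply hd
      have := hq h
      simpa [Finsupp.weight_apply, Finsupp.sum_fintype] using this
    rw [h0, Finset.sum_eq_zero]
    intro b _
    rw [if_neg, mul_zero]
    rintro rfl
    apply hd
    have := b.2
    simp [expo]
    omega

theorem symPow_apply (ℓ : ℕ) (A : Matrix (Fin 2) (Fin 2) ℂ) (i j : Fin (ℓ + 1)) :
    symPow ℓ A i j = (subst A (monomial (expo ℓ j) 1)).coeff (expo ℓ i) := by
  rw [monomial_expo]
  simp [symPow, subst, expo]

theorem subst_mul (A B : Matrix (Fin 2) (Fin 2) ℂ) (q : MvPolynomial (Fin 2) ℂ) :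
    subst (A * B) q = subst A (subst B q) := by
  have : subst (A * B) = (subst A).comp (subst B) := by
    apply MvPolynomial.algHom_ext
    intro j
    simp only [subst, aeval_X, AlgHom.comp_apply, map_add, map_mul, Matrix.mul_apply,
      Fin.sum_univ_two, algHom_C, algebraMap_eq]
    ring
  rw [this, AlgHom.comp_apply]

/-- Symmetric powers are functorial. -/
theorem symPow_mul (ℓ : ℕ) (A B : Matrix (Fin 2) (Fin 2) ℂ) :
    symPow ℓ (A * B) = symPow ℓ A * symPow ℓ B := by
  ext i j
  rw [symPow_apply, subst_mul, eq_sum_monomial_expo (isHomogeneous_subst_monomial ℓ B j),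
    Matrix.mul_apply]
  simp only [map_sum, map_mul, algHom_C, algebraMap_eq, coeff_sum, coeff_C_mul, symPow_apply]
  exact Finset.sum_congr rfl fun k _ => mul_comm _ _

theorem symPow_one (ℓ : ℕ) : symPow ℓ 1 = 1 := by
  ext i j
  have : subst 1 = AlgHom.id ℂ _ := by
    apply MvPolynomial.algHom_ext
    intro j
    fin_cases j <;> simp [subst]
  rw [symPow_apply, this, AlgHom.id_apply, coeff_monomial, Matrix.one_apply]
  simp only [expo_inj, Fin.ext_iff, eq_comm]

theorem rep_mul (n : ℤ) (ℓ : ℕ) (A B : Matrix (Fin 2) (Fin 2) ℂ) :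
    rep n ℓ (A * B) = rep n ℓ A * rep n ℓ B := by
  simp only [rep, Matrix.det_mul, mul_zpow, symPow_mul, smul_mul_smul_comm]

theorem rep_one (n : ℤ) (ℓ : ℕ) : rep n ℓ 1 = 1 := by
  simp [rep, symPow_one]

theorem isUnit_rep (n : ℤ) (ℓ : ℕ) {A : Matrix (Fin 2) (Fin 2) ℂ} (hA : A.det ≠ 0) :
    IsUnit (rep n ℓ A) := by
  refine IsUnit.of_mul_eq_one (rep n ℓ A⁻¹) ?_
  rw [← rep_mul, Matrix.mul_nonsing_inv _ (isUnit_iff_ne_zero.2 hA), rep_one]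

/-! ### The derivative of `π` -/

/-- The product rule for curves of polynomials, coefficient by coefficient: no topology on the
polynomial ring is needed. -/
theorem hasDerivAt_coeff_mul {P Q : ℝ → MvPolynomial (Fin 2) ℂ} {P' Q' : MvPolynomial (Fin 2) ℂ}
    {t : ℝ} (hP : ∀ d, HasDerivAt (fun s => (P s).coeff d) (P'.coeff d) t)
    (hQ : ∀ d, HasDerivAt (fun s => (Q s).coeff d) (Q'.coeff d) t) (d : Fin 2 →₀ ℕ) :
    HasDerivAt (fun s => (P s * Q s).coeff d) ((P' * Q t + P t * Q').coeff d) t := by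
  simp only [coeff_add, coeff_mul, ← Finset.sum_add_distrib]
  exact HasDerivAt.fun_sum fun x _ => (hP x.1).mul (hQ x.2)

theorem hasDerivAt_coeff_pow {P : ℝ → MvPolynomial (Fin 2) ℂ} {P' : MvPolynomial (Fin 2) ℂ}
    {t : ℝ} (hP : ∀ d, HasDerivAt (fun s => (P s).coeff d) (P'.coeff d) t) (k : ℕ) :
    ∀ d, HasDerivAt (fun s => (P s ^ k).coeff d) (((k : MvPolynomial (Fin 2) ℂ)
      * P t ^ (k - 1) * P').coeff d) t := by
  induction k with
  | zero => intro d; simpa using hasDerivAt_const _ _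
  | succ k ih =>
    intro d
    have := hasDerivAt_coeff_mul ih hP d
    simp only [pow_succ]
    convert this using 2
    rcases k with _ | k
    · simp
    · simp only [Nat.add_sub_cancel]; push_cast; ring

theorem differentiableAt_coeff_mul {E : Type*} [NormedAddCommGroup E] [NormedSpace ℂ E]
    {P Q : E → MvPolynomial (Fin 2) ℂ} {x : E}
    (hP : ∀ d, DifferentiableAt ℂ (fun s => (P s).coeff d) x)
    (hQ : ∀ d, DifferentiableAt ℂ (fun s => (Q s).coeff d) x) (d : Fin 2 →₀ ℕ) :
    DifferentiableAt ℂ (fun s => (P s * Q s).coeff d) x := by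
  simp only [coeff_mul]
  exact DifferentiableAt.fun_sum fun x _ => (hP x.1).mul (hQ x.2)

theorem differentiableAt_coeff_pow {E : Type*} [NormedAddCommGroup E] [NormedSpace ℂ E]
    {P : E → MvPolynomial (Fin 2) ℂ} {x : E}
    (hP : ∀ d, DifferentiableAt ℂ (fun s => (P s).coeff d) x) (k : ℕ) :
    ∀ d, DifferentiableAt ℂ (fun s => (P s ^ k).coeff d) x := by
  induction k with
  | zero => intro d; simp
  | succ k ih =>
    intro d
    simp only [pow_succ]
    exact differentiableAt_coeff_mul ih hP d

theorem differentiableAt_entry {i j : Fin 2} {A : Matrix (Fin 2) (Fin 2) ℂ} :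
    DifferentiableAt ℂ (fun B : Matrix (Fin 2) (Fin 2) ℂ => B i j) A :=
  (entryCLM i j).differentiableAt

theorem differentiableAt_symPow (ℓ : ℕ) (A : Matrix (Fin 2) (Fin 2) ℂ) :
    DifferentiableAt ℂ (symPow ℓ) A := by
  have hlin : ∀ (k : Fin 2) (d : Fin 2 →₀ ℕ), DifferentiableAt ℂ
      (fun B : Matrix (Fin 2) (Fin 2) ℂ =>
        (C (B 0 k) * X 0 + C (B 1 k) * X 1 : MvPolynomial (Fin 2) ℂ).coeff d) A := by
    intro k d
    simp only [coeff_add, coeff_C_mul]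
    exact (differentiableAt_entry.mul_const _).add (differentiableAt_entry.mul_const _)
  refine differentiableAt_matrix fun i j => ?_
  exact differentiableAt_coeff_mul (differentiableAt_coeff_pow (hlin 0) _)
    (differentiableAt_coeff_pow (hlin 1) _) _

theorem differentiableAt_rep (n : ℤ) (ℓ : ℕ) {A : Matrix (Fin 2) (Fin 2) ℂ} (hA : A.det ≠ 0) :
    DifferentiableAt ℂ (rep n ℓ) A := by
  have hdet : DifferentiableAt ℂ (fun B : Matrix (Fin 2) (Fin 2) ℂ => B.det) A := by
    simp only [Matrix.det_fin_two]
    exact (differentiableAt_entry.mul differentiableAt_entry).sub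
      (differentiableAt_entry.mul differentiableAt_entry)
  exact (hdet.zpow (Or.inl hA)).smul (differentiableAt_symPow ℓ A)

/-- The differential of `π` at the identity, as a complex linear map. -/
def dRep (n : ℤ) (ℓ : ℕ) : Matrix (Fin 2) (Fin 2) ℂ →L[ℂ] EndV ℓ := fderiv ℂ (rep n ℓ) 1

theorem hasDerivAt_rep_of_one {n : ℤ} {ℓ : ℕ} {A : ℝ → Matrix (Fin 2) (Fin 2) ℂ}
    {B : Matrix (Fin 2) (Fin 2) ℂ} (hA : HasDerivAt A B 0) (h1 : A 0 = 1) :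
    HasDerivAt (fun t => rep n ℓ (A t)) (dRep n ℓ B) 0 := by
  have h := (differentiableAt_rep n ℓ (A := 1) (by simp)).hasFDerivAt.restrictScalars ℝ
  rw [← h1] at h
  have h2 := h.comp_hasDerivAt (0 : ℝ) hA
  rw [h1] at h2
  exact h2

theorem drep_eq (n : ℤ) (ℓ : ℕ) (Y : Matrix (Fin 2) (Fin 2) ℂ) : drep n ℓ Y = dRep n ℓ Y :=
  (hasDerivAt_rep_of_one (hasDerivAt_exp_smul Y) (by simp)).deriv

/-- The derivative of `π` along a curve through any invertible matrix, by left translation to the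
identity. -/
theorem hasDerivAt_rep {n : ℤ} {ℓ : ℕ} {A : ℝ → Matrix (Fin 2) (Fin 2) ℂ}
    {B : Matrix (Fin 2) (Fin 2) ℂ} (hA : HasDerivAt A B 0) (h0 : (A 0).det ≠ 0) :
    HasDerivAt (fun t => rep n ℓ (A t)) (rep n ℓ (A 0) * dRep n ℓ ((A 0)⁻¹ * B)) 0 := by
  have hu : IsUnit (A 0).det := isUnit_iff_ne_zero.2 h0
  have h1 : HasDerivAt (fun t => (A 0)⁻¹ * A t) ((A 0)⁻¹ * B) 0 := hA.const_mul _
  have h2 := (hasDerivAt_rep_of_one (n := n) (ℓ := ℓ) h1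
    (Matrix.nonsing_inv_mul _ hu)).const_mul (rep n ℓ (A 0))
  refine h2.congr_of_eventuallyEq (Filter.Eventually.of_forall fun t => ?_)
  simp only
  rw [← rep_mul, ← mul_assoc, Matrix.mul_nonsing_inv _ hu, one_mul]

/-- The same derivative by right translation; the two forms serve the fields in `𝔨_ℂ` and the fields
`X_{-β}`, `X_{-γ}` respectively. -/
theorem hasDerivAt_rep_right {n : ℤ} {ℓ : ℕ} {A : ℝ → Matrix (Fin 2) (Fin 2) ℂ}
    {B : Matrix (Fin 2) (Fin 2) ℂ} (hA : HasDerivAt A B 0) (h0 : (A 0).det ≠ 0) :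
    HasDerivAt (fun t => rep n ℓ (A t)) (dRep n ℓ (B * (A 0)⁻¹) * rep n ℓ (A 0)) 0 := by
  have hu : IsUnit (A 0).det := isUnit_iff_ne_zero.2 h0
  have h1 : HasDerivAt (fun t => A t * (A 0)⁻¹) (B * (A 0)⁻¹) 0 := hA.mul_const _
  have h2 := (hasDerivAt_rep_of_one (n := n) (ℓ := ℓ) h1
    (Matrix.mul_nonsing_inv _ hu)).mul_const (rep n ℓ (A 0))
  refine h2.congr_of_eventuallyEq (Filter.Eventually.of_forall fun t => ?_)
  simp only
  rw [← rep_mul, mul_assoc, Matrix.nonsing_inv_mul _ hu, mul_one]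

/-- The explicit matrix of `π̇(Y)` in the monomial basis. -/
theorem dRep_apply (n : ℤ) (ℓ : ℕ) (Y : Matrix (Fin 2) (Fin 2) ℂ) (i j : Fin (ℓ + 1)) :
    dRep n ℓ Y i j =
      (if (i : ℕ) = j then (n : ℂ) * (Y 0 0 + Y 1 1) + ((ℓ : ℂ) - (j : ℕ)) * Y 0 0
        + ((j : ℕ) : ℂ) * Y 1 1 else 0)
      + (if (i : ℕ) = j + 1 then ((ℓ : ℂ) - (j : ℕ)) * Y 1 0 else 0)
      + (if (i : ℕ) + 1 = j then ((j : ℕ) : ℂ) * Y 0 1 else 0) := by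
  have hcurve : HasDerivAt (fun t : ℝ => (1 : Matrix (Fin 2) (Fin 2) ℂ) + t • Y) Y 0 := by
    have h := ((hasDerivAt_id (0 : ℝ)).smul_const Y).const_add (1 : Matrix (Fin 2) (Fin 2) ℂ)
    rw [one_smul] at h
    exact h
  have h := hasDerivAt_entry (hasDerivAt_rep_of_one (n := n) (ℓ := ℓ) hcurve (by simp)) i j
  refine h.unique ?_
  have hent : ∀ a b, HasDerivAt (fun t : ℝ => ((1 : Matrix (Fin 2) (Fin 2) ℂ) + t • Y) a b)
    (Y a b) 0 := fun a b => hasDerivAt_entry hcurve a b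
  have hlin : ∀ (k : Fin 2) (d : Fin 2 →₀ ℕ), HasDerivAt
      (fun t : ℝ => (C (((1 : Matrix (Fin 2) (Fin 2) ℂ) + t • Y) 0 k) * X 0
        + C (((1 : Matrix (Fin 2) (Fin 2) ℂ) + t • Y) 1 k) * X 1 :
          MvPolynomial (Fin 2) ℂ).coeff d)
      ((C (Y 0 k) * X 0 + C (Y 1 k) * X 1 : MvPolynomial (Fin 2) ℂ).coeff d) 0 := by
    intro k d
    simp only [coeff_add, coeff_C_mul]
    exact ((hent 0 k).mul_const _).add ((hent 1 k).mul_const _)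
  have hsym := hasDerivAt_coeff_mul (hasDerivAt_coeff_pow (hlin 0) (ℓ - j))
    (hasDerivAt_coeff_pow (hlin 1) j) (expo ℓ i)
  have hdet : HasDerivAt (fun t : ℝ => ((1 : Matrix (Fin 2) (Fin 2) ℂ) + t • Y).det ^ n)
      ((n : ℂ) * (Y 0 0 + Y 1 1)) 0 := by
    have h1 : HasDerivAt (fun t : ℝ => ((1 : Matrix (Fin 2) (Fin 2) ℂ) + t • Y).det)
        (Y 0 0 + Y 1 1) 0 := by
      simp only [Matrix.det_fin_two]
      refine (((hent 0 0).mul (hent 1 1)).sub ((hent 0 1).mul (hent 1 0))).congr_deriv ?_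
      simp
    have h2 := (hasDerivAt_zpow n (1 : ℂ) (by simp)).comp_of_eq (0 : ℝ) h1 (by simp)
    rw [one_zpow, mul_one] at h2
    exact h2
  refine (hdet.mul hsym).congr_deriv ?_
  have hj := j.2
  -- the Leibniz derivative of `(e₁ + t Y e₁)^(ℓ-j) (e₂ + t Y e₂)^j` at `t = 0`; the terms with a
  -- truncated exponent have coefficient zero
  have hpoly : ((ℓ - j : ℕ) : MvPolynomial (Fin 2) ℂ) * X 0 ^ (ℓ - j - 1)
        * (C (Y 0 0) * X 0 + C (Y 1 0) * X 1) * X 1 ^ (j : ℕ)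
      + X 0 ^ (ℓ - j) * (((j : ℕ) : MvPolynomial (Fin 2) ℂ) * X 1 ^ ((j : ℕ) - 1)
        * (C (Y 0 1) * X 0 + C (Y 1 1) * X 1))
      = C (((ℓ : ℂ) - (j : ℕ)) * Y 0 0 + ((j : ℕ) : ℂ) * Y 1 1) * monomial (expo ℓ j) 1
        + C (((ℓ : ℂ) - (j : ℕ)) * Y 1 0) * monomial (expo ℓ (j + 1)) 1
        + C (((j : ℕ) : ℂ) * Y 0 1) * monomial (expo ℓ (j - 1)) 1 := by
    generalize (j : ℕ) = k at hj
    obtain ⟨m, rfl⟩ : ∃ m, ℓ = k + m := ⟨ℓ - k, by omega⟩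
    simp only [monomial_expo, Nat.add_sub_cancel_left, Nat.cast_add, add_sub_cancel_left, C_add,
      C_mul, map_natCast]
    rcases m with _ | m <;> rcases k with _ | k
    · simp
    · rw [show k + 1 + 0 - (k + 1 - 1) = 1 by omega]
      simp only [Nat.add_sub_cancel, Nat.cast_zero, Nat.cast_add, Nat.cast_one]
      ring
    · rw [show 0 + (m + 1) - (0 + 1) = m by omega]
      simp only [Nat.add_sub_cancel, Nat.cast_zero, Nat.cast_add, Nat.cast_one]
      ring
    · rw [show k + 1 + (m + 1) - (k + 1 + 1) = m by omega,
        show k + 1 + (m + 1) - (k + 1 - 1) = m + 2 by omega]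
      simp only [Nat.add_sub_cancel, Nat.cast_add, Nat.cast_one]
      ring
  have h00 : (C 1 * X 0 + C 0 * X 1 : MvPolynomial (Fin 2) ℂ) = X 0 := by simp
  have h11 : (C 0 * X 0 + C 1 * X 1 : MvPolynomial (Fin 2) ℂ) = X 1 := by simp
  simp only [zero_smul, add_zero, Matrix.det_one, one_zpow, one_mul, Matrix.one_apply_eq,
    Matrix.one_apply_ne (zero_ne_one' (Fin 2)), Matrix.one_apply_ne (one_ne_zero' (Fin 2)),
    h00, h11, hpoly, ← monomial_expo]
  simp only [coeff_add, coeff_C_mul, coeff_monomial, expo_inj, eq_comm (b := (i : ℕ))]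
  by_cases h0 : (j : ℕ) = 0
  · simp [h0]
    split_ifs <;> ring
  · have hiff : ((i : ℕ) = (j : ℕ) - 1) ↔ ((i : ℕ) + 1 = j) := by omega
    simp only [hiff, mul_ite, mul_one, mul_zero]
    split_ifs <;> ring

end SymmetricPower

/-! ### Wirtinger derivatives on `ℂ²` -/

/-- The derivative of `H` at `z` in the direction `w`. -/
def dirDeriv {E : Type*} [NormedAddCommGroup E] [NormedSpace ℝ E] (H : ℂ × ℂ → E)
    (z w : ℂ × ℂ) : E :=
  fderiv ℝ H z w

/-- The Wirtinger derivative `∂H(z)(w)`, the complex linear part of the differential. -/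
def wirt {E : Type*} [NormedAddCommGroup E] [NormedSpace ℝ E] [NormedSpace ℂ E]
    (H : ℂ × ℂ → E) (z w : ℂ × ℂ) : E :=
  (1 / 2 : ℂ) • (dirDeriv H z w - Complex.I • dirDeriv H z (Complex.I • w))

/-- The second differential of `H` at `z`. -/
def hess {E : Type*} [NormedAddCommGroup E] [NormedSpace ℝ E]
    (H : ℂ × ℂ → E) (z v w : ℂ × ℂ) : E :=
  fderiv ℝ (fderiv ℝ H) z v w

theorem smul_eq_re_im {E : Type*} [AddCommGroup E] [Module ℂ E] (c : ℂ) (w : E) :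
    c • w = (c.re : ℂ) • w + (c.im : ℂ) • (Complex.I • w) := by
  conv_lhs => rw [← Complex.re_add_im c, add_smul, mul_smul]

section
variable {E : Type*} [NormedAddCommGroup E] [NormedSpace ℝ E]

theorem dirDeriv_add (H : ℂ × ℂ → E) (z w w' : ℂ × ℂ) :
    dirDeriv H z (w + w') = dirDeriv H z w + dirDeriv H z w' := by simp [dirDeriv]

theorem dirDeriv_neg (H : ℂ × ℂ → E) (z w : ℂ × ℂ) :
    dirDeriv H z (-w) = -dirDeriv H z w := by simp [dirDeriv]

theorem dirDeriv_smul (H : ℂ × ℂ → E) (z w : ℂ × ℂ) (c : ℝ) :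
    dirDeriv H z (c • w) = c • dirDeriv H z w := by simp [dirDeriv]

theorem hess_add_left (H : ℂ × ℂ → E) (z v v' w : ℂ × ℂ) :
    hess H z (v + v') w = hess H z v w + hess H z v' w := by simp [hess]

theorem hess_add_right (H : ℂ × ℂ → E) (z v w w' : ℂ × ℂ) :
    hess H z v (w + w') = hess H z v w + hess H z v w' := by simp [hess]

theorem hess_smul_left (H : ℂ × ℂ → E) (z v w : ℂ × ℂ) (c : ℝ) :
    hess H z (c • v) w = c • hess H z v w := by simp [hess]

theorem hess_smul_right (H : ℂ × ℂ → E) (z v w : ℂ × ℂ) (c : ℝ) :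
    hess H z v (c • w) = c • hess H z v w := by simp [hess]

theorem hess_neg_left (H : ℂ × ℂ → E) (z v w : ℂ × ℂ) :
    hess H z (-v) w = -hess H z v w := by simp [hess]

theorem hess_symm {H : ℂ × ℂ → E} (hH : ContDiff ℝ ∞ H) (z v w : ℂ × ℂ) :
    hess H z v w = hess H z w v :=
  ((contDiff_infty.1 hH 2).contDiffAt.isSymmSndFDerivAt (by simp)).eq _ _

/-- The sum of a real Hessian over the complex line spanned by `(a, b)`, in coordinates. -/
theorem hess_add_hess_I {H : ℂ × ℂ → E} (hH : ContDiff ℝ ∞ H) (z : ℂ × ℂ) (a b : ℂ) :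
    hess H z (a, b) (a, b) + hess H z (Complex.I • (a, b)) (Complex.I • (a, b))
      = Complex.normSq a • (hess H z (1, 0) (1, 0) + hess H z (Complex.I, 0) (Complex.I, 0))
        + Complex.normSq b • (hess H z (0, 1) (0, 1) + hess H z (0, Complex.I) (0, Complex.I))
        + (2 * (a * star b).re) •
          (hess H z (1, 0) (0, 1) + hess H z (Complex.I, 0) (0, Complex.I))
        - (2 * (a * star b).im) •
          (hess H z (1, 0) (0, Complex.I) - hess H z (Complex.I, 0) (0, 1)) := by
  have h1 : ((a, b) : ℂ × ℂ) = a.re • ((1, 0) : ℂ × ℂ) + a.im • ((Complex.I, 0) : ℂ × ℂ)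
      + b.re • ((0, 1) : ℂ × ℂ) + b.im • ((0, Complex.I) : ℂ × ℂ) := by
    ext <;> simp
  have h2 : Complex.I • ((a, b) : ℂ × ℂ) = (-a.im) • ((1, 0) : ℂ × ℂ)
      + a.re • ((Complex.I, 0) : ℂ × ℂ)
      + (-b.im) • ((0, 1) : ℂ × ℂ) + b.re • ((0, Complex.I) : ℂ × ℂ) := by
    ext <;> simp <;> apply Complex.ext <;> simp
  rw [h2, h1]
  simp only [hess_add_left, hess_add_right, hess_smul_left, hess_smul_right,
    hess_symm hH z (Complex.I, 0) (1, 0), hess_symm hH z (0, 1) (1, 0),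
    hess_symm hH z (0, Complex.I) (1, 0), hess_symm hH z (0, 1) (Complex.I, 0),
    hess_symm hH z (0, Complex.I) (Complex.I, 0), hess_symm hH z (0, Complex.I) (0, 1),
    Complex.normSq_apply, Complex.mul_re, Complex.mul_im, Complex.star_def, Complex.conj_re,
    Complex.conj_im]
  module

theorem hasDerivAt_dirDeriv {H : ℂ × ℂ → E} (hH : ContDiff ℝ ∞ H) {q w : ℝ → ℂ × ℂ}
    {v w' : ℂ × ℂ} {t : ℝ} (hq : HasDerivAt q v t) (hw : HasDerivAt w w' t) :
    HasDerivAt (fun s => dirDeriv H (q s) (w s))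
      (hess H (q t) v (w t) + dirDeriv H (q t) w') t := by
  have hH' : Differentiable ℝ (fderiv ℝ H) :=
    ((contDiff_infty.1 hH 2).fderiv_right (m := 1) (by norm_num)).differentiable (by simp)
  exact ((hH' (q t)).hasFDerivAt.comp_hasDerivAt t hq).clm_apply hw

theorem hasDerivAt_comp {H : ℂ × ℂ → E} (hH : ContDiff ℝ ∞ H) {q : ℝ → ℂ × ℂ}
    {v : ℂ × ℂ} {t : ℝ} (hq : HasDerivAt q v t) :
    HasDerivAt (fun s => H (q s)) (dirDeriv H (q t) v) t :=
  (hH.differentiable (by simp) (q t)).hasFDerivAt.comp_hasDerivAt t hq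

variable [NormedSpace ℂ E]

theorem dirDeriv_add_I_smul [IsScalarTower ℝ ℂ E] [SMulCommClass ℝ ℂ E] (H : ℂ × ℂ → E)
    (z w : ℂ × ℂ) :
    dirDeriv H z ((1 / 2 : ℝ) • w) + Complex.I • dirDeriv H z (-((1 / 2 : ℝ) • (Complex.I • w)))
      = wirt H z w := by
  rw [dirDeriv_neg, dirDeriv_smul, dirDeriv_smul, wirt]
  module

theorem wirt_add (H : ℂ × ℂ → E) (z w w' : ℂ × ℂ) :
    wirt H z (w + w') = wirt H z w + wirt H z w' := by
  simp only [wirt, dirDeriv_add, smul_add]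
  module

theorem wirt_smul [IsScalarTower ℝ ℂ E] (H : ℂ × ℂ → E) (z w : ℂ × ℂ) (c : ℂ) :
    wirt H z (c • w) = c • wirt H z w := by
  have hr : ∀ (r : ℝ) (w : ℂ × ℂ), dirDeriv H z ((r : ℂ) • w) = (r : ℂ) • dirDeriv H z w := by
    intro r w
    have := dirDeriv_smul H z w r
    rw [Complex.coe_smul, this, ← smul_one_smul ℂ r (dirDeriv H z w), Complex.real_smul, mul_one]
  have hI : ∀ v : ℂ × ℂ, dirDeriv H z (Complex.I • Complex.I • v) = - dirDeriv H z v := by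
    intro v
    rw [smul_smul, Complex.I_mul_I, neg_one_smul, dirDeriv_neg]
  rw [smul_eq_re_im c w, smul_eq_re_im c (wirt H z w)]
  simp only [wirt, smul_add, dirDeriv_add, hr, smul_comm Complex.I (_ : ℂ) (_ : ℂ × ℂ), hI]
  generalize dirDeriv H z w = a
  generalize dirDeriv H z (Complex.I • w) = b
  have : Complex.I * Complex.I = -1 := Complex.I_mul_I
  linear_combination (norm := module) ((c.im : ℂ) / 2 * this) • b

/-- The derivative of `∂H(q)(w)` along a curve on which `q` moves with velocity `v` and `w` with
velocity `β w`. -/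
theorem hasDerivAt_wirt [IsScalarTower ℝ ℂ E] [SMulCommClass ℝ ℂ E] {H : ℂ × ℂ → E}
    (hH : ContDiff ℝ ∞ H) {q w : ℝ → ℂ × ℂ} {v : ℂ × ℂ} {β : ℂ} (hq : HasDerivAt q v 0)
    (hw : HasDerivAt w (β • w 0) 0) :
    HasDerivAt (fun t => wirt H (q t) (w t))
      ((1 / 2 : ℂ) • (hess H (q 0) v (w 0) - Complex.I • hess H (q 0) v (Complex.I • w 0))
        + β • wirt H (q 0) (w 0)) 0 := by
  have h2 := hasDerivAt_dirDeriv hH hq hw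
  have h3 := hasDerivAt_dirDeriv hH hq (hw.const_smul Complex.I)
  refine ((h2.sub (h3.const_smul Complex.I)).const_smul (1 / 2 : ℂ)).congr_deriv ?_
  rw [← wirt_smul, wirt]
  module

end

/-! ### Left-invariant vector fields -/

theorem mul_expG_zero (g : G) (Y : su3) : g * expG ((0 : ℝ) • Y) = g := by
  apply Subtype.ext
  change g.1 * NormedSpace.exp (((0 : ℝ) • Y : su3) : Matrix (Fin 3) (Fin 3) ℂ) = g.1
  rw [zero_smul, Submodule.coe_zero, NormedSpace.exp_zero, mul_one]

theorem field_eq {ℓ : ℕ} {X : sl3} {F : G → EndV ℓ} {g : G} {a b : EndV ℓ}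
    (ha : HasDerivAt (fun t : ℝ => F (g * expG (t • skewRe X))) a 0)
    (hb : HasDerivAt (fun t : ℝ => F (g * expG (t • skewIm X))) b 0) :
    field X F g = a + Complex.I • b := by
  have ha' : realField (skewRe X) F g = a := ha.deriv
  have hb' : realField (skewIm X) F g = b := hb.deriv
  rw [field, ha', hb']

theorem hasDerivAt_block (g : G) (Y : su3) :
    HasDerivAt (fun t : ℝ => block (g * expG (t • Y)).1) (block (g.1 * Y.1)) 0 := by
  refine hasDerivAt_matrix (n := Fin 2) fun i j => ?_
  fin_cases i <;> fin_cases j <;> exact hasDerivAt_curve g Y _ _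

theorem eventually_mem_𝒜 {g : G} (hg : g ∈ 𝒜) (Y : su3) :
    ∀ᶠ t : ℝ in nhds 0, g * expG (t • Y) ∈ 𝒜 := by
  have h : ContinuousAt (fun t : ℝ => (block (g * expG (t • Y)).1).det) 0 := by
    simp only [Matrix.det_fin_two]
    have h := fun i j => (hasDerivAt_entry (hasDerivAt_block g Y) i j).continuousAt
    exact ((h 0 0).mul (h 1 1)).sub ((h 0 1).mul (h 1 0))
  refine h.eventually_ne ?_
  rw [mul_expG_zero]
  exact hg

/-- Values on `𝒜` suffice, because `𝒜` is open along one-parameter curves. -/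
theorem field_congr {ℓ : ℕ} {X : sl3} {F₁ F₂ : G → EndV ℓ} (h : ∀ g ∈ 𝒜, F₁ g = F₂ g) {g : G}
    (hg : g ∈ 𝒜) : field X F₁ g = field X F₂ g := by
  have : ∀ Y : su3, realField Y F₁ g = realField Y F₂ g := fun Y =>
    Filter.EventuallyEq.deriv_eq ((eventually_mem_𝒜 hg Y).mono fun t ht => h _ ht)
  rw [field, field, this, this]

/-- `F` is differentiable at `g` along every one-parameter subgroup. -/
def DiffAlong {ℓ : ℕ} (F : G → EndV ℓ) (g : G) : Prop :=
  ∀ Y : su3, DifferentiableAt ℝ (fun t : ℝ => F (g * expG (t • Y))) 0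

theorem DiffAlong.congr {ℓ : ℕ} {F₁ F₂ : G → EndV ℓ} {g : G} (h₂ : DiffAlong F₂ g)
    (h : ∀ g ∈ 𝒜, F₁ g = F₂ g) (hg : g ∈ 𝒜) : DiffAlong F₁ g := fun Y =>
  (h₂ Y).congr_of_eventuallyEq ((eventually_mem_𝒜 hg Y).mono fun _ ht => h _ ht)

theorem DiffAlong.mul {ℓ : ℕ} {F₁ F₂ : G → EndV ℓ} {g : G} (h₁ : DiffAlong F₁ g)
    (h₂ : DiffAlong F₂ g) : DiffAlong (fun x => F₁ x * F₂ x) g := fun Y => (h₁ Y).mul (h₂ Y)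

theorem diffAlong_const {ℓ : ℕ} (c : EndV ℓ) (g : G) : DiffAlong (fun _ => c) g := fun _ =>
  differentiableAt_const c

theorem field_mul {ℓ : ℕ} {X : sl3} {F₁ F₂ : G → EndV ℓ} {g : G} (h₁ : DiffAlong F₁ g)
    (h₂ : DiffAlong F₂ g) :
    field X (fun x => F₁ x * F₂ x) g = field X F₁ g * F₂ g + F₁ g * field X F₂ g := by
  have key : ∀ Y : su3, HasDerivAt (fun t : ℝ => F₁ (g * expG (t • Y)) * F₂ (g * expG (t • Y)))
      (realField Y F₁ g * F₂ g + F₁ g * realField Y F₂ g) 0 := by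
    intro Y
    have := (h₁ Y).hasDerivAt.mul (h₂ Y).hasDerivAt
    rw [mul_expG_zero] at this
    exact this
  rw [field_eq (key _) (key _), field, field, add_mul, mul_add, smul_add, smul_mul_assoc,
    mul_smul_comm]
  abel

theorem field_const {ℓ : ℕ} (X : sl3) (c : EndV ℓ) (g : G) : field X (fun _ => c) g = 0 := by
  rw [field_eq (hasDerivAt_const _ c) (hasDerivAt_const _ c)]
  simp

theorem field_mul_const {ℓ : ℕ} {X : sl3} {F : G → EndV ℓ} {g : G} (h : DiffAlong F g)
    (c : EndV ℓ) : field X (fun x => F x * c) g = field X F g * c := by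
  rw [field_mul h (diffAlong_const c g), field_const, mul_zero, add_zero]

/-! ### The function `Φ_π` -/

theorem det_block_ne_zero {g : G} (hg : g ∈ 𝒜) : (block g.1).det ≠ 0 := hg

theorem hasDerivAt_Φ (n : ℤ) (ℓ : ℕ) {g : G} (hg : g ∈ 𝒜) (Y : su3) :
    HasDerivAt (fun t : ℝ => Φ n ℓ (g * expG (t • Y)))
      (Φ n ℓ g * dRep n ℓ ((block g.1)⁻¹ * block (g.1 * Y.1))) 0 := by
  have h := hasDerivAt_rep (n := n) (ℓ := ℓ) (hasDerivAt_block g Y)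
    (by rw [mul_expG_zero]; exact hg)
  rw [mul_expG_zero] at h
  exact h

theorem diffAlong_Φ (n : ℤ) (ℓ : ℕ) {g : G} (hg : g ∈ 𝒜) : DiffAlong (Φ n ℓ) g := fun Y =>
  (hasDerivAt_Φ n ℓ hg Y).differentiableAt

theorem block_add (A B : Matrix (Fin 3) (Fin 3) ℂ) : block (A + B) = block A + block B := by
  ext i j; fin_cases i <;> fin_cases j <;> rfl

theorem block_smul (c : ℂ) (A : Matrix (Fin 3) (Fin 3) ℂ) : block (c • A) = c • block A := by
  ext i j; fin_cases i <;> fin_cases j <;> rfl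

/-- `Φ_π` is the restriction of a holomorphic function, so that complexified vector fields act on
it through the complex differential. -/
theorem field_Φ (n : ℤ) (ℓ : ℕ) (X : sl3) {g : G} (hg : g ∈ 𝒜) :
    field X (Φ n ℓ) g = Φ n ℓ g * dRep n ℓ ((block g.1)⁻¹ * block (g.1 * X.1)) := by
  rw [field_eq (hasDerivAt_Φ n ℓ hg _) (hasDerivAt_Φ n ℓ hg _), ← mul_smul_comm, ← mul_add,
    ← map_smul, ← map_add, ← mul_smul_comm, ← mul_add, ← block_smul, ← block_add, ← mul_smul_comm,
    ← mul_add, ← skewRe_add_skewIm]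

theorem field_Φ_right (n : ℤ) (ℓ : ℕ) (X : sl3) {g : G} (hg : g ∈ 𝒜) :
    field X (Φ n ℓ) g = dRep n ℓ (block (g.1 * X.1) * (block g.1)⁻¹) * Φ n ℓ g := by
  have key : ∀ Y : su3, HasDerivAt (fun t : ℝ => Φ n ℓ (g * expG (t • Y)))
      (dRep n ℓ (block (g.1 * Y.1) * (block g.1)⁻¹) * Φ n ℓ g) 0 := by
    intro Y
    have h := hasDerivAt_rep_right (n := n) (ℓ := ℓ) (hasDerivAt_block g Y)
      (by rw [mul_expG_zero]; exact hg)
    rw [mul_expG_zero] at h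
    exact h
  rw [field_eq (key _) (key _), ← smul_mul_assoc, ← add_mul,
    ← map_smul, ← map_add, ← smul_mul_assoc, ← add_mul, ← block_smul, ← block_add, ← mul_smul_comm,
    ← mul_add, ← skewRe_add_skewIm]

theorem isUnit_Φ (n : ℤ) (ℓ : ℕ) {g : G} (hg : g ∈ 𝒜) : IsUnit (Φ n ℓ g) := isUnit_rep n ℓ hg

theorem block_mul_of_blockDiag (g : Matrix (Fin 3) (Fin 3) ℂ) {X : Matrix (Fin 3) (Fin 3) ℂ}
    (h0 : X 2 0 = 0) (h1 : X 2 1 = 0) : block (g * X) = block g * block X := by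
  ext i j
  fin_cases i <;> fin_cases j <;>
    simp [block, Matrix.mul_apply, Fin.sum_univ_three, Fin.sum_univ_two, h0, h1]

theorem field_Φ_of_blockDiag (n : ℤ) (ℓ : ℕ) {X : sl3} (h0 : X.1 2 0 = 0) (h1 : X.1 2 1 = 0)
    {g : G} (hg : g ∈ 𝒜) : field X (Φ n ℓ) g = Φ n ℓ g * dRep n ℓ (block X.1) := by
  rw [field_Φ n ℓ X hg, block_mul_of_blockDiag _ h0 h1, ← mul_assoc,
    Matrix.nonsing_inv_mul _ (isUnit_iff_ne_zero.2 hg), one_mul]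

/-! ### Functions on the affine plane -/

theorem star_mul_entry (g : G) (i j : Fin 3) :
    star (g.1 0 i) * g.1 0 j + star (g.1 1 i) * g.1 1 j + star (g.1 2 i) * g.1 2 j
      = if i = j then 1 else 0 := by
  have h := (Matrix.mem_unitaryGroup_iff'.1 (Matrix.mem_specialUnitaryGroup_iff.1 g.2).1)
  have h2 := congrFun (congrFun h i) j
  rwa [Matrix.mul_apply, Fin.sum_univ_three, Matrix.one_apply] at h2

theorem mul_star_entry (g : G) (i j : Fin 3) :
    g.1 i 0 * star (g.1 j 0) + g.1 i 1 * star (g.1 j 1) + g.1 i 2 * star (g.1 j 2)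
      = if i = j then 1 else 0 := by
  have h := (Matrix.mem_unitaryGroup_iff.1 (Matrix.mem_specialUnitaryGroup_iff.1 g.2).1)
  have h2 := congrFun (congrFun h i) j
  rwa [Matrix.mul_apply, Fin.sum_univ_three, Matrix.one_apply] at h2

/-- By Cramer's rule for `g⁻¹ = g*`; so `𝒜` is also the set where `g₂₂ ≠ 0`. -/
theorem det_block_eq (g : G) : (block g.1).det = star (g.1 2 2) := by
  obtain ⟨h1, h2⟩ := Matrix.mem_specialUnitaryGroup_iff.1 g.2
  have h3 : g.1.adjugate = star g.1 := by
    have := Matrix.mem_unitaryGroup_iff.1 h1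
    calc g.1.adjugate = g.1.adjugate * (g.1 * star g.1) := by rw [this, mul_one]
      _ = star g.1 := by rw [← mul_assoc, Matrix.adjugate_mul, h2, one_smul, one_mul]
  have h4 := congrFun (congrFun h3 2) 2
  rw [Matrix.adjugate_fin_three] at h4
  simpa [Matrix.det_fin_two, block] using h4

theorem entry_ne_zero {g : G} (hg : g ∈ 𝒜) : g.1 2 2 ≠ 0 := by
  intro h
  apply det_block_ne_zero hg
  rw [det_block_eq, h, star_zero]

theorem p_eq (g : G) : p g = (g.1 0 2 / g.1 2 2, g.1 1 2 / g.1 2 2) := by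
  simp [p, act]

/-- The differential of `M ↦ (M₀₂ / M₂₂, M₁₂ / M₂₂)` at `g`. -/
def dp (g : G) (V : Matrix (Fin 3) (Fin 3) ℂ) : ℂ × ℂ :=
  ((V 0 2 * g.1 2 2 - g.1 0 2 * V 2 2) / g.1 2 2 ^ 2,
   (V 1 2 * g.1 2 2 - g.1 1 2 * V 2 2) / g.1 2 2 ^ 2)

theorem hasDerivAt_p {g : G} (hg : g ∈ 𝒜) (Y : su3) :
    HasDerivAt (fun t : ℝ => p (g * expG (t • Y))) (dp g (g.1 * Y.1)) 0 := by
  simp only [p_eq]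
  have h := hasDerivAt_curve g Y
  have h22 : (g * expG ((0 : ℝ) • Y)).1 2 2 ≠ 0 := by
    rw [mul_expG_zero]; exact entry_ne_zero hg
  refine (((h 0 2).div (h 2 2) h22).prodMk ((h 1 2).div (h 2 2) h22)).congr_deriv ?_
  simp only [mul_expG_zero, dp]

theorem hasDerivAt_comp_p {ℓ : ℕ} {H : ℂ × ℂ → EndV ℓ} (hH : ContDiff ℝ ∞ H) {g : G}
    (hg : g ∈ 𝒜) (Y : su3) :
    HasDerivAt (fun t : ℝ => H (p (g * expG (t • Y)))) (dirDeriv H (p g) (dp g (g.1 * Y.1))) 0 := by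
  have h := hasDerivAt_comp hH (hasDerivAt_p hg Y)
  rw [mul_expG_zero] at h
  exact h

theorem diffAlong_comp_p {ℓ : ℕ} {H : ℂ × ℂ → EndV ℓ} (hH : ContDiff ℝ ∞ H) {g : G}
    (hg : g ∈ 𝒜) : DiffAlong (fun x => H (p x)) g := fun Y =>
  (hasDerivAt_comp_p hH hg Y).differentiableAt

/-- `p` is right invariant under `K`. -/
theorem field_comp_p_of_blockDiag {ℓ : ℕ} {H : ℂ × ℂ → EndV ℓ} (hH : ContDiff ℝ ∞ H) {X : sl3}
    (h0 : X.1 2 0 = 0) (h1 : X.1 2 1 = 0) (h2 : X.1 0 2 = 0) (h3 : X.1 1 2 = 0) {g : G}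
    (hg : g ∈ 𝒜) : field X (fun x => H (p x)) g = 0 := by
  have key : ∀ Y : su3, Y.1 0 2 = 0 → Y.1 1 2 = 0 → dp g (g.1 * Y.1) = 0 := by
    intro Y hY0 hY1
    simp only [dp, Matrix.mul_apply, Fin.sum_univ_three, hY0, hY1]
    ext <;> simp <;> left <;> ring
  rw [field_eq (hasDerivAt_comp_p hH hg _) (hasDerivAt_comp_p hH hg _), key, key]
  · simp [dirDeriv]
  all_goals simp [skewRe, skewIm, h0, h1, h2, h3]

/-! ### The vector fields transversal to `K` -/

/-- The tangent vector `dp(g E_{c2})` of the affine plane at `p(g)`. -/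
def slope (c : Fin 3) (g : G) : ℂ × ℂ :=
  ((g.1 0 c * g.1 2 2 - g.1 0 2 * g.1 2 c) / g.1 2 2 ^ 2,
   (g.1 1 c * g.1 2 2 - g.1 1 2 * g.1 2 c) / g.1 2 2 ^ 2)

theorem mul_skewRe_apply {c : Fin 3} {X : sl3} (hX : X.1 = Matrix.single c 2 1) (g : G)
    (i j : Fin 3) : (g.1 * (skewRe X).1) i j
      = 1 / 2 * ((if j = 2 then g.1 i c else 0) - if j = c then g.1 i 2 else 0) := by
  simp only [skewRe, hX, Matrix.conjTranspose_single, star_one, Matrix.mul_smul, mul_sub,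
    Matrix.smul_apply, Matrix.sub_apply, smul_eq_mul]
  congr 2
  · split_ifs with h
    · subst h; simp
    · rw [Matrix.mul_single_apply_of_ne _ _ _ _ _ h]
  · split_ifs with h
    · subst h; simp
    · rw [Matrix.mul_single_apply_of_ne _ _ _ _ _ h]

theorem mul_skewIm_apply {c : Fin 3} {X : sl3} (hX : X.1 = Matrix.single c 2 1) (g : G)
    (i j : Fin 3) : (g.1 * (skewIm X).1) i j
      = -(Complex.I / 2) * ((if j = 2 then g.1 i c else 0) + if j = c then g.1 i 2 else 0) := by
  simp only [skewIm, hX, Matrix.conjTranspose_single, star_one, Matrix.mul_smul, mul_add,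
    Matrix.smul_apply, Matrix.add_apply, smul_eq_mul]
  congr 2
  · split_ifs with h
    · subst h; simp
    · rw [Matrix.mul_single_apply_of_ne _ _ _ _ _ h]
  · split_ifs with h
    · subst h; simp
    · rw [Matrix.mul_single_apply_of_ne _ _ _ _ _ h]

/-- Complex conjugation of `𝔤_ℂ` with respect to `𝔤` is `X ↦ -Xᴴ`. -/
theorem skewRe_transpose {X X' : sl3} (h : X'.1 = X.1ᴴ) : skewRe X' = -skewRe X := by
  apply Subtype.ext
  simp only [skewRe, h, Matrix.conjTranspose_conjTranspose, Submodule.coe_neg, ← smul_neg, neg_sub]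

theorem skewIm_transpose {X X' : sl3} (h : X'.1 = X.1ᴴ) : skewIm X' = skewIm X := by
  apply Subtype.ext
  simp only [skewIm, h, Matrix.conjTranspose_conjTranspose, add_comm]

theorem dp_skewRe {c : Fin 3} (hc : c ≠ 2) {X : sl3} (hX : X.1 = Matrix.single c 2 1) (g : G) :
    dp g (g.1 * (skewRe X).1) = (1 / 2 : ℝ) • slope c g := by
  simp only [dp, mul_skewRe_apply hX, slope, if_neg hc.symm, if_true, Prod.smul_mk,
    Complex.real_smul]
  push_cast
  ext <;> ring

theorem dp_skewIm {c : Fin 3} (hc : c ≠ 2) {X : sl3} (hX : X.1 = Matrix.single c 2 1) (g : G) :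
    dp g (g.1 * (skewIm X).1) = -((1 / 2 : ℝ) • (Complex.I • slope c g)) := by
  simp only [dp, mul_skewIm_apply hX, slope, if_neg hc.symm, if_true, Prod.smul_mk,
    Complex.real_smul, smul_eq_mul, Prod.neg_mk]
  push_cast
  ext <;> ring

theorem field_comp_p {ℓ : ℕ} {H : ℂ × ℂ → EndV ℓ} (hH : ContDiff ℝ ∞ H) {c : Fin 3} (hc : c ≠ 2)
    {X : sl3} (hX : X.1 = Matrix.single c 2 1) {g : G} (hg : g ∈ 𝒜) :
    field X (fun x => H (p x)) g = wirt H (p g) (slope c g) := by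
  rw [field_eq (hasDerivAt_comp_p hH hg _) (hasDerivAt_comp_p hH hg _), dp_skewRe hc hX,
    dp_skewIm hc hX, dirDeriv_add_I_smul]

/-- A criterion for the slope to move, to first order, along its own complex line. -/
theorem hasDerivAt_slope {c : Fin 3} {g : G} (hg : g ∈ 𝒜) (Y : su3) {β : ℂ}
    (h : ∀ i, (((g.1 * Y.1) i c * g.1 2 2 + g.1 i c * (g.1 * Y.1) 2 2
      - ((g.1 * Y.1) i 2 * g.1 2 c + g.1 i 2 * (g.1 * Y.1) 2 c)) * g.1 2 2
      - (g.1 i c * g.1 2 2 - g.1 i 2 * g.1 2 c) * (2 * (g.1 * Y.1) 2 2))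
      = β * (g.1 i c * g.1 2 2 - g.1 i 2 * g.1 2 c) * g.1 2 2) :
    HasDerivAt (fun t : ℝ => slope c (g * expG (t • Y))) (β • slope c g) 0 := by
  have hd := hasDerivAt_curve g Y
  have h22 : (g * expG ((0 : ℝ) • Y)).1 2 2 ^ 2 ≠ 0 := by
    rw [mul_expG_zero]; exact pow_ne_zero 2 (entry_ne_zero hg)
  have key : ∀ i, HasDerivAt (fun t : ℝ => ((g * expG (t • Y)).1 i c * (g * expG (t • Y)).1 2 2
      - (g * expG (t • Y)).1 i 2 * (g * expG (t • Y)).1 2 c) / (g * expG (t • Y)).1 2 2 ^ 2)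
      (β * ((g.1 i c * g.1 2 2 - g.1 i 2 * g.1 2 c) / g.1 2 2 ^ 2)) 0 := by
    intro i
    refine ((((hd i c).mul (hd 2 2)).sub ((hd i 2).mul (hd 2 c))).div ((hd 2 2).pow 2)
      h22).congr_deriv ?_
    simp only [mul_expG_zero, Pi.mul_apply, Pi.sub_apply, Pi.pow_apply]
    have := entry_ne_zero hg
    rw [div_eq_iff (by positivity), ← mul_div_assoc, div_mul_eq_mul_div, eq_div_iff (by positivity)]
    linear_combination (g.1 2 2) ^ 3 * h i
  exact (key 0).prodMk (key 1)

/-- `X_{-β} X_β` and `X_{-γ} X_γ` give `-∂̄∂H` in the direction of the slope: the field `X'` does not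
move `p` holomorphically, and the contributions of the moving slope cancel. -/
theorem field_field_comp_p {ℓ : ℕ} {H : ℂ × ℂ → EndV ℓ} (hH : ContDiff ℝ ∞ H) {c : Fin 3}
    (hc : c ≠ 2) {X X' : sl3} (hX : X.1 = Matrix.single c 2 1) (hX' : X'.1 = X.1ᴴ) {g : G}
    (hg : g ∈ 𝒜) :
    field X' (field X (fun x => H (p x))) g = (-(1 / 4) : ℂ) •
      (hess H (p g) (slope c g) (slope c g)
        + hess H (p g) (Complex.I • slope c g) (Complex.I • slope c g)) := by
  rw [field_congr (fun g hg => field_comp_p hH hc hX hg) hg]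
  have hne := entry_ne_zero hg
  have hs1 : HasDerivAt (fun t : ℝ => slope c (g * expG (t • skewRe X')))
      ((g.1 2 c / g.1 2 2) • slope c g) 0 := by
    refine hasDerivAt_slope hg _ fun i => ?_
    simp only [skewRe_transpose hX', Submodule.coe_neg, mul_neg, Matrix.neg_apply,
      mul_skewRe_apply hX, if_neg hc, if_neg hc.symm, if_true]
    field_simp
    ring
  have hs2 : HasDerivAt (fun t : ℝ => slope c (g * expG (t • skewIm X')))
      ((Complex.I * (g.1 2 c / g.1 2 2)) • slope c g) 0 := by
    refine hasDerivAt_slope hg _ fun i => ?_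
    simp only [skewIm_transpose hX',
      mul_skewIm_apply hX, if_neg hc, if_neg hc.symm, if_true]
    field_simp
    ring
  have hp1 := hasDerivAt_p hg (skewRe X')
  have hp2 := hasDerivAt_p hg (skewIm X')
  rw [skewRe_transpose hX', Submodule.coe_neg, mul_neg, ← skewRe_transpose hX'] at hp1
  rw [skewIm_transpose hX', dp_skewIm hc hX, ← skewIm_transpose hX'] at hp2
  have hneg : dp g (-(g.1 * (skewRe X).1)) = -((1 / 2 : ℝ) • slope c g) := by
    rw [← dp_skewRe hc hX]
    simp only [dp, Matrix.neg_apply, Prod.neg_mk]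
    ext <;> ring
  rw [hneg] at hp1
  have h1 := hasDerivAt_wirt hH hp1 (w := fun t : ℝ => slope c (g * expG (t • skewRe X')))
    (β := g.1 2 c / g.1 2 2) (by simpa only [mul_expG_zero] using hs1)
  have h2 := hasDerivAt_wirt hH hp2 (w := fun t : ℝ => slope c (g * expG (t • skewIm X')))
    (β := Complex.I * (g.1 2 c / g.1 2 2)) (by simpa only [mul_expG_zero] using hs2)
  rw [field_eq h1 h2]
  simp only [mul_expG_zero]
  simp only [hess_neg_left, hess_smul_left, hess_symm hH _ (Complex.I • slope c g) (slope c g)]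
  have hI : Complex.I * Complex.I = -1 := Complex.I_mul_I
  generalize wirt H (p g) (slope c g) = W
  generalize hess H (p g) (slope c g) (slope c g) = A
  generalize hess H (p g) (slope c g) (Complex.I • slope c g) = B
  generalize hess H (p g) (Complex.I • slope c g) (Complex.I • slope c g) = C
  -- the derivative of the slope enters as `W + I • (I • W) = 0`
  linear_combination (norm := module) (g.1 2 c / g.1 2 2 * hI) • W + (1 / 4 * hI) • C

theorem Xβ_eq : Xβ.1 = Matrix.single 1 2 1 := by
  ext i j; fin_cases i <;> fin_cases j <;> simp [Xβ, Matrix.single]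
theorem Xγ_eq : Xγ.1 = Matrix.single 0 2 1 := by
  ext i j; fin_cases i <;> fin_cases j <;> simp [Xγ, Matrix.single]
theorem Xmβ_eq : Xmβ.1 = Xβ.1ᴴ := by
  ext i j; fin_cases i <;> fin_cases j <;> simp [Xβ, Xmβ]
theorem Xmγ_eq : Xmγ.1 = Xγ.1ᴴ := by
  ext i j; fin_cases i <;> fin_cases j <;> simp [Xγ, Xmγ]

theorem differentiableAt_slope (c : Fin 3) {g : G} (hg : g ∈ 𝒜) (Y : su3) :
    DifferentiableAt ℝ (fun t : ℝ => slope c (g * expG (t • Y))) 0 := by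
  have hd := fun i j => (hasDerivAt_curve g Y i j).differentiableAt
  have h22 : (g * expG ((0 : ℝ) • Y)).1 2 2 ^ 2 ≠ 0 := by
    rw [mul_expG_zero]; exact pow_ne_zero 2 (entry_ne_zero hg)
  have key : ∀ i, DifferentiableAt ℝ (fun t : ℝ =>
      ((g * expG (t • Y)).1 i c * (g * expG (t • Y)).1 2 2
      - (g * expG (t • Y)).1 i 2 * (g * expG (t • Y)).1 2 c) / (g * expG (t • Y)).1 2 2 ^ 2) 0 :=
    fun i => (((hd i c).mul (hd 2 2)).sub ((hd i 2).mul (hd 2 c))).div ((hd 2 2).pow 2) h22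
  exact (key 0).prodMk (key 1)

theorem diffAlong_field_comp_p {ℓ : ℕ} {H : ℂ × ℂ → EndV ℓ} (hH : ContDiff ℝ ∞ H) {c : Fin 3}
    (hc : c ≠ 2) {X : sl3} (hX : X.1 = Matrix.single c 2 1) {g : G} (hg : g ∈ 𝒜) :
    DiffAlong (field X (fun x => H (p x))) g := by
  refine DiffAlong.congr (fun Y => ?_) (fun g hg => field_comp_p hH hc hX hg) hg
  have hp := hasDerivAt_p hg Y
  have hs := (differentiableAt_slope c hg Y).hasDerivAt
  exact (((hasDerivAt_dirDeriv hH hp hs).sub ((hasDerivAt_dirDeriv hH hp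
    (hs.const_smul Complex.I)).const_smul Complex.I)).const_smul (1 / 2 : ℂ)).differentiableAt

/-! ### The Casimir operator on `H Φ_π` -/

theorem block_mul_single (g : Matrix (Fin 3) (Fin 3) ℂ) (c : Fin 3) :
    block (g * Matrix.single c 2 1) = 0 := by
  ext i j
  fin_cases i <;> fin_cases j <;> simp [block]

theorem field_Φ_eq_zero (n : ℤ) (ℓ : ℕ) {c : Fin 3} {X : sl3} (hX : X.1 = Matrix.single c 2 1)
    {g : G} (hg : g ∈ 𝒜) : field X (Φ n ℓ) g = 0 := by
  rw [field_Φ n ℓ X hg, hX, block_mul_single, mul_zero, map_zero, mul_zero]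

/-- The elements of `𝔨_ℂ` differentiate only the factor `Φ_π`. -/
theorem field_mul_Φ_of_blockDiag (n : ℤ) {ℓ : ℕ} {H : ℂ × ℂ → EndV ℓ} (hH : ContDiff ℝ ∞ H)
    {X : sl3} (h0 : X.1 2 0 = 0) (h1 : X.1 2 1 = 0) (h2 : X.1 0 2 = 0) (h3 : X.1 1 2 = 0) {g : G}
    (hg : g ∈ 𝒜) : field X (fun x => H (p x) * Φ n ℓ x) g
      = H (p g) * Φ n ℓ g * dRep n ℓ (block X.1) := by
  rw [field_mul (diffAlong_comp_p hH hg) (diffAlong_Φ n ℓ hg),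
    field_comp_p_of_blockDiag hH h0 h1 h2 h3 hg, field_Φ_of_blockDiag n ℓ h0 h1 hg, zero_mul,
    zero_add, mul_assoc]

theorem field_field_mul_Φ_of_blockDiag (n : ℤ) {ℓ : ℕ} {H : ℂ × ℂ → EndV ℓ}
    (hH : ContDiff ℝ ∞ H) {X X' : sl3}
    (h0 : X.1 2 0 = 0) (h1 : X.1 2 1 = 0) (h2 : X.1 0 2 = 0) (h3 : X.1 1 2 = 0)
    (h0' : X'.1 2 0 = 0) (h1' : X'.1 2 1 = 0) (h2' : X'.1 0 2 = 0) (h3' : X'.1 1 2 = 0) {g : G}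
    (hg : g ∈ 𝒜) : field X' (field X (fun x => H (p x) * Φ n ℓ x)) g
      = H (p g) * Φ n ℓ g * (dRep n ℓ (block X'.1) * dRep n ℓ (block X.1)) := by
  rw [field_congr (fun g hg => field_mul_Φ_of_blockDiag n hH h0 h1 h2 h3 hg) hg,
    field_mul_const ((diffAlong_comp_p hH hg).mul (diffAlong_Φ n ℓ hg)),
    field_mul_Φ_of_blockDiag n hH h0' h1' h2' h3' hg, mul_assoc]

theorem field_field_mul_Φ (n : ℤ) {ℓ : ℕ} {H : ℂ × ℂ → EndV ℓ} (hH : ContDiff ℝ ∞ H) {c : Fin 3}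
    (hc : c ≠ 2) {X X' : sl3} (hX : X.1 = Matrix.single c 2 1) {g : G} (hg : g ∈ 𝒜) :
    field X' (field X (fun x => H (p x) * Φ n ℓ x)) g
      = (field X' (field X (fun x => H (p x))) g
        + field X (fun x => H (p x)) g * field X' (Φ n ℓ) g * (Φ n ℓ g)⁻¹) * Φ n ℓ g := by
  have h1 : ∀ g ∈ 𝒜, field X (fun x => H (p x) * Φ n ℓ x) g
      = field X (fun x => H (p x)) g * Φ n ℓ g := by
    intro g hg
    rw [field_mul (diffAlong_comp_p hH hg) (diffAlong_Φ n ℓ hg), field_Φ_eq_zero n ℓ hX hg,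
      mul_zero, add_zero]
  rw [field_congr h1 hg, field_mul (diffAlong_field_comp_p hH hc hX hg) (diffAlong_Φ n ℓ hg),
    add_mul, mul_assoc (_ * _) (_⁻¹),
    Matrix.nonsing_inv_mul _ ((Matrix.isUnit_iff_isUnit_det _).1 (isUnit_Φ n ℓ hg)), mul_one]

theorem Δ₂_mul_Φ (n : ℤ) {ℓ : ℕ} {H : ℂ × ℂ → EndV ℓ} (hH : ContDiff ℝ ∞ H) {g : G}
    (hg : g ∈ 𝒜) :
    Δ₂ (fun x => H (p x) * Φ n ℓ x) g =
      H (p g) * Φ n ℓ g * drepΔ₂K n ℓ + D n (fun x => H (p x)) g * Φ n ℓ g := by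
  have hα := @field_field_mul_Φ_of_blockDiag n ℓ H hH Xα Xmα (by simp [Xα]) (by simp [Xα])
    (by simp [Xα]) (by simp [Xα]) (by simp [Xmα]) (by simp [Xmα])
    (by simp [Xmα]) (by simp [Xmα]) g hg
  have hHα := @field_field_mul_Φ_of_blockDiag n ℓ H hH Hα Hα (by simp [Hα]) (by simp [Hα])
    (by simp [Hα]) (by simp [Hα]) (by simp [Hα]) (by simp [Hα])
    (by simp [Hα]) (by simp [Hα]) g hg
  have hHα' := @field_mul_Φ_of_blockDiag n ℓ H hH Hα (by simp [Hα]) (by simp [Hα])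
    (by simp [Hα]) (by simp [Hα]) g hg
  have hZ := @field_field_mul_Φ_of_blockDiag n ℓ H hH Z Z (by simp [Z, Hα, Hβ])
    (by simp [Z, Hα, Hβ]) (by simp [Z, Hα, Hβ]) (by simp [Z, Hα, Hβ]) (by simp [Z, Hα, Hβ])
    (by simp [Z, Hα, Hβ]) (by simp [Z, Hα, Hβ]) (by simp [Z, Hα, Hβ]) g hg
  have hZ' := @field_mul_Φ_of_blockDiag n ℓ H hH Z (by simp [Z, Hα, Hβ])
    (by simp [Z, Hα, Hβ]) (by simp [Z, Hα, Hβ]) (by simp [Z, Hα, Hβ]) g hg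
  have hβ := @field_field_mul_Φ n ℓ H hH 1 (by decide) Xβ Xmβ Xβ_eq g hg
  have hγ := @field_field_mul_Φ n ℓ H hH 0 (by decide) Xγ Xmγ Xγ_eq g hg
  rw [Δ₂, hα, hHα, hHα', hZ, hZ', hβ, hγ, D, D₁, D₂, drepΔ₂K]
  simp only [drep_eq, mul_sub, mul_neg, add_mul, mul_smul_comm, smul_mul_assoc, pow_two, smul_add]
  module

/-! ### Infinitesimal equivariance -/

theorem act_of_mem_K {k : G} (hk : k ∈ K) (z : ℂ × ℂ) :
    act k z = ((k.1 0 0 * z.1 + k.1 0 1 * z.2) / k.1 2 2,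
      (k.1 1 0 * z.1 + k.1 1 1 * z.2) / k.1 2 2) := by
  obtain ⟨h1, h2, h3, h4⟩ := hk
  simp [act, h1, h2, h3, h4]

theorem mem_𝒜_of_mem_K {k : G} (hk : k ∈ K) : k ∈ 𝒜 := by
  obtain ⟨h1, h2, h3, h4⟩ := hk
  change (block k.1).det ≠ 0
  rw [det_block_eq]
  intro h
  rw [star_eq_zero] at h
  have := star_mul_entry k 2 2
  simp [h1, h2, h] at this

/-- The vector field on `ℂ²` generated by the block diagonal matrix `Y`. -/
def planeField (Y : Matrix (Fin 3) (Fin 3) ℂ) (z : ℂ × ℂ) : ℂ × ℂ :=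
  (Y 0 0 * z.1 + Y 0 1 * z.2 - Y 2 2 * z.1, Y 1 0 * z.1 + Y 1 1 * z.2 - Y 2 2 * z.2)

/-- Differentiating `H(kz) π(k) = π(k) H(z)` along a curve in `K` through the identity. -/
theorem dirDeriv_of_equivariant {n : ℤ} {ℓ : ℕ} {H : ℂ × ℂ → EndV ℓ} (hH : ContDiff ℝ ∞ H)
    (hE : Equivariant n H) {k : ℝ → G} {Y : Matrix (Fin 3) (Fin 3) ℂ} (hk : ∀ t, k t ∈ K)
    (h0 : k 0 = 1) (hY : ∀ i j, HasDerivAt (fun t => (k t).1 i j) (Y i j) 0) (z : ℂ × ℂ) :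
    dirDeriv H z (planeField Y z) = dRep n ℓ (block Y) * H z - H z * dRep n ℓ (block Y) := by
  have hz : act (k 0) z = z := by rw [act_of_mem_K (hk 0), h0]; simp
  have hact : HasDerivAt (fun t => act (k t) z) (planeField Y z) 0 := by
    simp only [fun t => act_of_mem_K (hk t) z]
    have h22 : (k 0).1 2 2 ≠ 0 := by rw [h0]; simp
    refine (((((hY 0 0).mul_const z.1).add ((hY 0 1).mul_const z.2)).div (hY 2 2) h22).prodMk
      ((((hY 1 0).mul_const z.1).add ((hY 1 1).mul_const z.2)).div (hY 2 2) h22)).congr_deriv ?_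
    simp only [h0, planeField, Pi.add_apply]
    simp
    constructor <;> ring
  have h1 := hasDerivAt_comp hH hact
  rw [hz] at h1
  have hblock : HasDerivAt (fun t => block (k t).1) (block Y) 0 := by
    refine hasDerivAt_matrix (n := Fin 2) fun i j => ?_
    fin_cases i <;> fin_cases j <;> exact hY _ _
  have hb0 : block (k 0).1 = 1 := by
    rw [h0]; ext i j; fin_cases i <;> fin_cases j <;> simp [block]
  have h2 := hasDerivAt_rep_of_one (n := n) (ℓ := ℓ) hblock hb0
  have h3 := h1.mul h2
  have h4 : HasDerivAt (fun t => H (act (k t) z) * rep n ℓ (block (k t).1))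
      (dRep n ℓ (block Y) * H z) 0 := by
    refine (h2.mul_const (H z)).congr_of_eventuallyEq (Filter.Eventually.of_forall fun t => ?_)
    simp only
    rw [hE _ (hk t), mul_assoc (_ * _), Matrix.nonsing_inv_mul _
      ((Matrix.isUnit_iff_isUnit_det _).1 (isUnit_rep n ℓ (mem_𝒜_of_mem_K (hk t)))), mul_one]
  have h5 := h3.unique h4
  rw [hz, hb0, rep_one, mul_one] at h5
  rw [← h5, add_sub_cancel_right]

/-- The derivative of the infinitesimal equivariance in the direction `w`. -/
theorem hess_of_dirDeriv_eq {ℓ : ℕ} {H : ℂ × ℂ → EndV ℓ} (hH : ContDiff ℝ ∞ H)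
    {Y : Matrix (Fin 3) (Fin 3) ℂ} {C : EndV ℓ}
    (h : ∀ z, dirDeriv H z (planeField Y z) = C * H z - H z * C) (z w : ℂ × ℂ) :
    hess H z w (planeField Y z) + dirDeriv H z (planeField Y w)
      = C * dirDeriv H z w - dirDeriv H z w * C := by
  have hq : HasDerivAt (fun t : ℝ => z + t • w) w 0 := by
    simpa using ((hasDerivAt_id (0 : ℝ)).smul_const w).const_add z
  have hL : HasDerivAt (fun t : ℝ => planeField Y (z + t • w)) (planeField Y w) 0 := by
    have : (fun t : ℝ => planeField Y (z + t • w))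
        = fun t : ℝ => planeField Y z + t • planeField Y w := by
      funext t
      simp only [planeField, Prod.fst_add, Prod.snd_add, Prod.smul_fst, Prod.smul_snd,
        Complex.real_smul, Prod.smul_mk, Prod.mk_add_mk]
      ext <;> ring
    rw [this]
    simpa using ((hasDerivAt_id (0 : ℝ)).smul_const (planeField Y w)).const_add (planeField Y z)
  have h1 := hasDerivAt_dirDeriv hH hq hL
  simp only [h] at h1
  have h2 := hasDerivAt_comp hH hq
  have h3 := h1.unique ((h2.const_mul C).sub (h2.mul_const C))
  simpa using h3

/-! ### Curves in `K` -/

/-- The diagonal element `diag(e^{iat}, e^{ibt}, e^{-i(a+b)t})` of `SU(3)`. -/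
def torusCurve (a b t : ℝ) : G :=
  ⟨!![Complex.exp (a * t * Complex.I), 0, 0; 0, Complex.exp (b * t * Complex.I), 0;
    0, 0, Complex.exp (-(a + b) * t * Complex.I)], by
    have h : ∀ x y : ℝ, Complex.exp (x * y * Complex.I)
        * (starRingEnd ℂ) (Complex.exp (x * y * Complex.I)) = 1 := by
      intro x y
      rw [← Complex.exp_conj, ← Complex.exp_add]
      simp
    rw [Matrix.mem_specialUnitaryGroup_iff, Matrix.mem_unitaryGroup_iff]
    constructor
    · have h3 := h (-(a + b)) t
      push_cast at h3
      simp only [neg_mul] at h3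
      ext i j
      fin_cases i <;> fin_cases j <;>
        simp [Matrix.mul_apply, Fin.sum_univ_three, Matrix.star_apply, h, -neg_add_rev]
      exact h3
    · rw [Matrix.det_fin_three]
      simp [← Complex.exp_add, -neg_add_rev]
      rw [show (a : ℂ) * t * Complex.I + b * t * Complex.I + -((a + b) * t * Complex.I) = 0 by ring,
        Complex.exp_zero]⟩

theorem torusCurve_mem (a b t : ℝ) : torusCurve a b t ∈ K := by
  simp [torusCurve, K]

theorem torusCurve_zero (a b : ℝ) : torusCurve a b 0 = 1 := by
  apply Subtype.ext
  ext i j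
  fin_cases i <;> fin_cases j <;> simp [torusCurve]

theorem hasDerivAt_torusCurve (a b : ℝ) (i j : Fin 3) :
    HasDerivAt (fun t => (torusCurve a b t).1 i j)
      ((!![a * Complex.I, 0, 0; 0, b * Complex.I, 0; 0, 0, -(a + b) * Complex.I] :
        Matrix (Fin 3) (Fin 3) ℂ) i j) 0 := by
  have h : ∀ c : ℂ, HasDerivAt (fun t : ℝ => Complex.exp (c * t * Complex.I))
      (c * Complex.I) 0 := by
    intro c
    have h1 : HasDerivAt (fun t : ℝ => c * (t : ℂ) * Complex.I) (c * Complex.I) 0 := by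
      simpa using ((Complex.ofRealCLM.hasDerivAt (x := (0 : ℝ))).const_mul c).mul_const Complex.I
    simpa using h1.cexp
  fin_cases i <;> fin_cases j <;>
    first
    | exact h _
    | exact hasDerivAt_const _ _

/-- The rotation `(cos t, -ω̄ sin t; ω sin t, cos t)` in `K`, for `|ω| = 1`. -/
def rotCurve {w : ℂ} (hw : w * star w = 1) (t : ℝ) : G :=
  ⟨!![Complex.cos t, -star w * Complex.sin t, 0; w * Complex.sin t, Complex.cos t, 0; 0, 0, 1], by
    have h := Complex.cos_sq_add_sin_sq t
    have hw' : w * (starRingEnd ℂ) w = 1 := hw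
    rw [Matrix.mem_specialUnitaryGroup_iff, Matrix.mem_unitaryGroup_iff]
    constructor
    · ext i j
      fin_cases i <;> fin_cases j <;>
        simp [Matrix.mul_apply, Fin.sum_univ_three, Matrix.star_apply, ← Complex.cos_conj,
          ← Complex.sin_conj]
      · linear_combination h + Complex.sin t ^ 2 * hw'
      · ring
      · ring
      · linear_combination h + Complex.sin t ^ 2 * hw'
    · rw [Matrix.det_fin_three]
      simp
      linear_combination h + Complex.sin t ^ 2 * hw'⟩

theorem rotCurve_mem {w : ℂ} (hw : w * star w = 1) (t : ℝ) : rotCurve hw t ∈ K := by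
  simp [rotCurve, K]

theorem rotCurve_zero {w : ℂ} (hw : w * star w = 1) : rotCurve hw 0 = 1 := by
  apply Subtype.ext
  ext i j
  fin_cases i <;> fin_cases j <;> simp [rotCurve]

theorem hasDerivAt_rotCurve {w : ℂ} (hw : w * star w = 1) (i j : Fin 3) :
    HasDerivAt (fun t => (rotCurve hw t).1 i j)
      ((!![0, -star w, 0; w, 0, 0; 0, 0, 0] : Matrix (Fin 3) (Fin 3) ℂ) i j) 0 := by
  have hc : HasDerivAt (fun t : ℝ => Complex.cos t) 0 0 := by
    simpa using (Complex.hasDerivAt_cos ((0 : ℝ) : ℂ)).comp_ofReal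
  have hs : HasDerivAt (fun t : ℝ => Complex.sin t) 1 0 := by
    simpa using (Complex.hasDerivAt_sin ((0 : ℝ) : ℂ)).comp_ofReal
  have hs' : ∀ c : ℂ, HasDerivAt (fun t : ℝ => c * Complex.sin t) c 0 := by
    intro c
    simpa using hs.const_mul c
  fin_cases i <;> fin_cases j <;>
    first
    | exact hc
    | exact hs' _
    | exact hasDerivAt_const _ _

theorem dRep_one (n : ℤ) (ℓ : ℕ) : dRep n ℓ 1 = (2 * (n : ℂ) + ℓ) • (1 : EndV ℓ) := by
  ext i j
  rw [dRep_apply, Matrix.smul_apply, Matrix.one_apply]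
  by_cases h : i = j
  · subst h
    simp
    ring
  · have : (i : ℕ) ≠ j := fun h' => h (Fin.ext h')
    simp [h, this]

/-! ### Derivatives of an equivariant function on the first axis -/

section Axis

variable {n : ℤ} {ℓ : ℕ} {H : ℂ × ℂ → EndV ℓ}

theorem dirDeriv_torus (hH : ContDiff ℝ ∞ H) (hE : Equivariant n H) (a b : ℝ) (z : ℂ × ℂ) :
    dirDeriv H z (planeField !![a * Complex.I, 0, 0; 0, b * Complex.I, 0;
        0, 0, -(a + b) * Complex.I] z)
      = dRep n ℓ !![a * Complex.I, 0; 0, b * Complex.I] * H z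
        - H z * dRep n ℓ !![a * Complex.I, 0; 0, b * Complex.I] :=
  dirDeriv_of_equivariant hH hE (torusCurve_mem a b) (torusCurve_zero a b)
    (hasDerivAt_torusCurve a b) z

theorem dirDeriv_rot (hH : ContDiff ℝ ∞ H) (hE : Equivariant n H) {w : ℂ} (hw : w * star w = 1)
    (z : ℂ × ℂ) :
    dirDeriv H z (planeField !![0, -star w, 0; w, 0, 0; 0, 0, 0] z)
      = dRep n ℓ !![0, -star w; w, 0] * H z - H z * dRep n ℓ !![0, -star w; w, 0] :=
  dirDeriv_of_equivariant hH hE (rotCurve_mem hw) (rotCurve_zero hw) (hasDerivAt_rotCurve hw) z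

/-- The stabilizer in `K` of a point of the first axis acts on `V_π` with a simple spectrum. Together
with the scalars `π̇(1)` its Lie algebra spans the diagonal matrices. -/
theorem commute_dRep_diag (hH : ContDiff ℝ ∞ H) (hE : Equivariant n H) (r : ℝ) (a b : ℂ) :
    dRep n ℓ !![a, 0; 0, b] * radial H r = radial H r * dRep n ℓ !![a, 0; 0, b] := by
  have h := dirDeriv_torus hH hE 1 (-2) ((r : ℂ), 0)
  have h0 : planeField !![(1 : ℝ) * Complex.I, 0, 0; 0, (-2 : ℝ) * Complex.I, 0;
      0, 0, -((1 : ℝ) + (-2 : ℝ)) * Complex.I] ((r : ℂ), 0) = 0 := by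
    simp [planeField]
    ring
  rw [h0, show dirDeriv H ((r : ℂ), 0) 0 = 0 by simp [dirDeriv], eq_comm, sub_eq_zero] at h
  have hd : (!![a, 0; 0, b] : Matrix (Fin 2) (Fin 2) ℂ)
      = ((2 * a + b) / 3) • (1 : Matrix (Fin 2) (Fin 2) ℂ)
        + (-Complex.I * (a - b) / 3) •
          !![(1 : ℝ) * Complex.I, 0; 0, (-2 : ℝ) * Complex.I] := by
    ext i j
    fin_cases i <;> fin_cases j <;> simp
    · linear_combination (a - b) / 3 * Complex.I_mul_I
    · linear_combination 2 * (b - a) / 3 * Complex.I_mul_I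
  rw [hd, map_add, map_smul, map_smul, dRep_one, add_mul, mul_add]
  congr 1
  · simp only [smul_mul_assoc, mul_smul_comm, one_mul, mul_one]
  · simp only [smul_mul_assoc, mul_smul_comm]
    exact congrArg _ h

theorem hasDerivAt_radial (hH : ContDiff ℝ ∞ H) (r : ℝ) :
    HasDerivAt (radial H) (dirDeriv H ((r : ℂ), 0) (1, 0)) r := by
  have hq : HasDerivAt (fun s : ℝ => (((s : ℂ), 0) : ℂ × ℂ)) (1, 0) r :=
    (Complex.ofRealCLM.hasDerivAt (x := r)).prodMk (hasDerivAt_const r (0 : ℂ))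
  exact hasDerivAt_comp hH hq

theorem deriv_radial (hH : ContDiff ℝ ∞ H) :
    deriv (radial H) = fun r : ℝ => dirDeriv H ((r : ℂ), 0) (1, 0) :=
  funext fun r => (hasDerivAt_radial hH r).deriv

theorem deriv_deriv_radial (hH : ContDiff ℝ ∞ H) (r : ℝ) :
    deriv (deriv (radial H)) r = hess H ((r : ℂ), 0) (1, 0) (1, 0) := by
  have hq : HasDerivAt (fun s : ℝ => (((s : ℂ), 0) : ℂ × ℂ)) (1, 0) r :=
    (Complex.ofRealCLM.hasDerivAt (x := r)).prodMk (hasDerivAt_const r (0 : ℂ))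
  rw [deriv_radial hH]
  have h := hasDerivAt_dirDeriv hH hq (hasDerivAt_const r ((1, 0) : ℂ × ℂ))
  refine h.deriv.trans ?_
  simp [dirDeriv]

theorem commute_dRep_diag_deriv (hH : ContDiff ℝ ∞ H) (hE : Equivariant n H) (r : ℝ) (a b : ℂ) :
    dRep n ℓ !![a, 0; 0, b] * deriv (radial H) r
      = deriv (radial H) r * dRep n ℓ !![a, 0; 0, b] := by
  have h := hasDerivAt_radial hH r
  rw [deriv_radial hH]
  have h1 := h.const_mul (dRep n ℓ !![a, 0; 0, b])
  have h2 := h.mul_const (dRep n ℓ !![a, 0; 0, b])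
  simp only [commute_dRep_diag hH hE] at h1
  exact h1.unique h2

/-- `H(e^{is} r, 0)` is constant in `s`: the torus acts on `H(r, 0)` trivially. -/
theorem dirDeriv_I_axis (hH : ContDiff ℝ ∞ H) (hE : Equivariant n H) {r : ℝ} (hr : r ≠ 0) :
    dirDeriv H ((r : ℂ), 0) (Complex.I, 0) = 0 := by
  have h := dirDeriv_torus hH hE 0 1 ((r : ℂ), 0)
  have h0 : planeField !![(0 : ℝ) * Complex.I, 0, 0; 0, (1 : ℝ) * Complex.I, 0;
      0, 0, -((0 : ℝ) + (1 : ℝ)) * Complex.I] ((r : ℂ), 0) = r • ((Complex.I, 0) : ℂ × ℂ) := by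
    simp [planeField, mul_comm]
  have hc := commute_dRep_diag hH hE r ((0 : ℝ) * Complex.I) ((1 : ℝ) * Complex.I)
  rw [radial] at hc
  rw [h0, dirDeriv_smul, hc, sub_self] at h
  exact (smul_eq_zero.1 h).resolve_left hr

theorem hess_I_axis (hH : ContDiff ℝ ∞ H) (hE : Equivariant n H) {r : ℝ} (hr : r ≠ 0) :
    hess H ((r : ℂ), 0) (Complex.I, 0) (Complex.I, 0) = (1 / r) • deriv (radial H) r := by
  have h := hess_of_dirDeriv_eq hH (dirDeriv_torus hH hE 0 1) ((r : ℂ), 0) (Complex.I, 0)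
  have h0 : planeField !![(0 : ℝ) * Complex.I, 0, 0; 0, (1 : ℝ) * Complex.I, 0;
      0, 0, -((0 : ℝ) + (1 : ℝ)) * Complex.I] ((r : ℂ), 0) = r • ((Complex.I, 0) : ℂ × ℂ) := by
    simp [planeField, mul_comm]
  have h1 : planeField !![(0 : ℝ) * Complex.I, 0, 0; 0, (1 : ℝ) * Complex.I, 0;
      0, 0, -((0 : ℝ) + (1 : ℝ)) * Complex.I] (Complex.I, 0) = -((1, 0) : ℂ × ℂ) := by
    simp [planeField]
  rw [h0, h1, dirDeriv_I_axis hH hE hr, mul_zero, zero_mul, sub_self, dirDeriv_neg,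
    hess_smul_right] at h
  rw [deriv_radial hH]
  simp only
  rw [← add_neg_eq_zero.1 h, smul_smul, one_div_mul_cancel hr, one_smul]

/-- For `ω = 1` and `ω = i` the generator of the rotation is `-J` and `iT`. -/
theorem smul_dirDeriv_rot (hH : ContDiff ℝ ∞ H) (hE : Equivariant n H) {w : ℂ}
    (hw : w * star w = 1) (r : ℝ) :
    r • dirDeriv H ((r : ℂ), 0) (0, w)
      = dRep n ℓ !![0, -star w; w, 0] * radial H r
        - radial H r * dRep n ℓ !![0, -star w; w, 0] := by
  have h0 : planeField !![0, -star w, 0; w, 0, 0; 0, 0, 0] ((r : ℂ), 0)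
      = r • ((0, w) : ℂ × ℂ) := by
    simp [planeField, mul_comm]
  rw [← dirDeriv_smul, ← h0]
  exact dirDeriv_rot hH hE hw _

/-- The term `r H̃'` is the curvature of the orbit of `(r, 0)`. -/
theorem smul_hess_rot (hH : ContDiff ℝ ∞ H) (hE : Equivariant n H) {w : ℂ}
    (hw : w * star w = 1) (r : ℝ) :
    (r ^ 2) • hess H ((r : ℂ), 0) (0, w) (0, w)
      = (dRep n ℓ !![0, -star w; w, 0]) ^ 2 * radial H r
        + radial H r * (dRep n ℓ !![0, -star w; w, 0]) ^ 2
        - (2 : ℝ) • (dRep n ℓ !![0, -star w; w, 0] * radial H r * dRep n ℓ !![0, -star w; w, 0])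
        + r • deriv (radial H) r := by
  have h0 : planeField !![0, -star w, 0; w, 0, 0; 0, 0, 0] ((r : ℂ), 0)
      = r • ((0, w) : ℂ × ℂ) := by
    simp [planeField, mul_comm]
  have h1 : planeField !![0, -star w, 0; w, 0, 0; 0, 0, 0] (r • ((0, w) : ℂ × ℂ))
      = -(r • ((1, 0) : ℂ × ℂ)) := by
    simp only [planeField]
    ext
    · simp
      have hw' : w * (starRingEnd ℂ) w = 1 := hw
      linear_combination (r : ℂ) * hw'
    · simp
  have h := hess_of_dirDeriv_eq hH (dirDeriv_rot hH hE hw) ((r : ℂ), 0) (r • ((0, w) : ℂ × ℂ))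
  rw [h0, h1, dirDeriv_neg, dirDeriv_smul, dirDeriv_smul, smul_dirDeriv_rot hH hE hw,
    hess_smul_left, hess_smul_right, smul_smul, ← pow_two, ← sub_eq_add_neg,
    sub_eq_iff_eq_add] at h
  rw [h, deriv_radial hH]
  congr 1
  rw [two_smul]
  noncomm_ring

end Axis

/-! ### The operator `D` on the first axis -/

section AxisPoint

variable {g : G} {r : ℝ}

theorem entries_of_p_eq (hg : g ∈ 𝒜) (hp : p g = ((r : ℂ), 0)) :
    g.1 0 2 = r * g.1 2 2 ∧ g.1 1 2 = 0 := by
  rw [p_eq, Prod.mk.injEq] at hp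
  have hne := entry_ne_zero hg
  exact ⟨(div_eq_iff hne).1 hp.1, (div_eq_zero_iff.1 hp.2).resolve_right hne⟩

/-- Orthogonality of the columns of `g` to its last column `g₂₂ (r, 0, 1)`. -/
theorem entry_two_of_p_eq (hg : g ∈ 𝒜) (hp : p g = ((r : ℂ), 0)) {c : Fin 3} (hc : c ≠ 2) :
    g.1 2 c = -(r * g.1 0 c) := by
  obtain ⟨h0, h1⟩ := entries_of_p_eq hg hp
  have hne : star (g.1 2 2) ≠ 0 := star_ne_zero.2 (entry_ne_zero hg)
  have h := star_mul_entry g 2 c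
  rw [h0, h1, if_neg hc.symm, star_mul', star_zero, zero_mul, add_zero,
    show star (r : ℂ) = r from Complex.conj_ofReal r] at h
  have h2 : star (g.1 2 2) * (r * g.1 0 c + g.1 2 c) = 0 := by linear_combination h
  linear_combination (mul_eq_zero.1 h2).resolve_left hne

theorem slope_of_p_eq (hg : g ∈ 𝒜) (hp : p g = ((r : ℂ), 0)) {c : Fin 3} (hc : c ≠ 2) :
    slope c g = ((1 + (r : ℂ) ^ 2) * g.1 0 c / g.1 2 2, g.1 1 c / g.1 2 2) := by
  obtain ⟨h0, h1⟩ := entries_of_p_eq hg hp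
  have hne := entry_ne_zero hg
  rw [slope, entry_two_of_p_eq hg hp hc, h0, h1]
  ext
  · simp only; field_simp; ring
  · simp only; field_simp; ring

theorem normSq_of_p_eq (hg : g ∈ 𝒜) (hp : p g = ((r : ℂ), 0)) :
    Complex.normSq (g.1 2 2) * (1 + r ^ 2) = 1 := by
  obtain ⟨h0, h1⟩ := entries_of_p_eq hg hp
  have h := star_mul_entry g 2 2
  rw [h0, h1, if_pos rfl, star_mul', show star (r : ℂ) = r from Complex.conj_ofReal r] at h
  have h2 : ((Complex.normSq (g.1 2 2) * (1 + r ^ 2) : ℝ) : ℂ) = (1 : ℝ) := by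
    push_cast
    rw [Complex.normSq_eq_conj_mul_self]
    rw [Complex.star_def] at h
    linear_combination h
  exact_mod_cast h2

theorem row_normSq (g : G) (i : Fin 3) :
    Complex.normSq (g.1 i 0) + Complex.normSq (g.1 i 1) + Complex.normSq (g.1 i 2) = 1 := by
  have h := mul_star_entry g i i
  have h2 : ((Complex.normSq (g.1 i 0) + Complex.normSq (g.1 i 1) + Complex.normSq (g.1 i 2) : ℝ)
      : ℂ) = (1 : ℝ) := by
    push_cast
    simp only [← Complex.mul_conj]
    simpa using h
  exact_mod_cast h2

variable {n : ℤ} {ℓ : ℕ} {H : ℂ × ℂ → EndV ℓ}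

theorem field_field_eq_hess (hH : ContDiff ℝ ∞ H) {c : Fin 3} (hc : c ≠ 2) {X X' : sl3}
    (hX : X.1 = Matrix.single c 2 1) (hX' : X'.1 = X.1ᴴ) (hg : g ∈ 𝒜)
    (hp : p g = ((r : ℂ), 0)) :
    field X' (field X (fun x => H (p x))) g = (-(1 / 4) : ℂ) •
      (((1 + r ^ 2) ^ 3 * Complex.normSq (g.1 0 c)) •
          (hess H ((r : ℂ), 0) (1, 0) (1, 0) + hess H ((r : ℂ), 0) (Complex.I, 0) (Complex.I, 0))
        + ((1 + r ^ 2) * Complex.normSq (g.1 1 c)) •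
          (hess H ((r : ℂ), 0) (0, 1) (0, 1) + hess H ((r : ℂ), 0) (0, Complex.I) (0, Complex.I))
        + (2 * (1 + r ^ 2) ^ 2 * (g.1 0 c * star (g.1 1 c)).re) •
          (hess H ((r : ℂ), 0) (1, 0) (0, 1) + hess H ((r : ℂ), 0) (Complex.I, 0) (0, Complex.I))
        - (2 * (1 + r ^ 2) ^ 2 * (g.1 0 c * star (g.1 1 c)).im) •
          (hess H ((r : ℂ), 0) (1, 0) (0, Complex.I)
            - hess H ((r : ℂ), 0) (Complex.I, 0) (0, 1))) := by
  rw [field_field_comp_p hH hc hX hX' hg, hp, slope_of_p_eq hg hp hc, hess_add_hess_I hH]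
  have hN := normSq_of_p_eq hg hp
  have hpos : (0 : ℝ) < 1 + r ^ 2 := by positivity
  have hN' : Complex.normSq (g.1 2 2) = (1 + r ^ 2)⁻¹ := eq_inv_of_mul_eq_one_left hN
  have hr : Complex.normSq (1 + (r : ℂ) ^ 2) = (1 + r ^ 2) ^ 2 := by
    rw [show (1 + (r : ℂ) ^ 2) = ((1 + r ^ 2 : ℝ) : ℂ) by push_cast; rfl, Complex.normSq_ofReal]
    ring
  have ha : Complex.normSq ((1 + (r : ℂ) ^ 2) * g.1 0 c / g.1 2 2)
      = (1 + r ^ 2) ^ 3 * Complex.normSq (g.1 0 c) := by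
    rw [Complex.normSq_div, Complex.normSq_mul, hN', hr]
    field_simp
  have hb : Complex.normSq (g.1 1 c / g.1 2 2) = (1 + r ^ 2) * Complex.normSq (g.1 1 c) := by
    rw [Complex.normSq_div, hN']
    field_simp
  have hab : (1 + (r : ℂ) ^ 2) * g.1 0 c / g.1 2 2 * star (g.1 1 c / g.1 2 2)
      = (((1 + r ^ 2) ^ 2 : ℝ) : ℂ) * (g.1 0 c * star (g.1 1 c)) := by
    have hm : g.1 2 2 * star (g.1 2 2) = (((1 + r ^ 2)⁻¹ : ℝ) : ℂ) := by
      rw [Complex.star_def, Complex.mul_conj, hN']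
    have hpos' : (1 + (r : ℂ) ^ 2) ≠ 0 := by exact_mod_cast hpos.ne'
    rw [star_div₀, div_mul_div_comm, hm]
    push_cast
    field_simp
  rw [ha, hb, hab, Complex.re_ofReal_mul, Complex.im_ofReal_mul, ← mul_assoc, ← mul_assoc]

/-- The rows of `g` are orthonormal, hence the tangent vectors `dp(g E₁₃)` and `dp(g E₂₃)` form an
orthogonal frame up to the weights `(1 + r²)²` and `1 + r²` on the two coordinate axes. -/
theorem D₁_of_p_eq (hH : ContDiff ℝ ∞ H) (hg : g ∈ 𝒜) (hp : p g = ((r : ℂ), 0)) :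
    D₁ (fun x => H (p x)) g
      = ((1 + r ^ 2) ^ 2) • (hess H ((r : ℂ), 0) (1, 0) (1, 0)
          + hess H ((r : ℂ), 0) (Complex.I, 0) (Complex.I, 0))
        + (1 + r ^ 2) • (hess H ((r : ℂ), 0) (0, 1) (0, 1)
          + hess H ((r : ℂ), 0) (0, Complex.I) (0, Complex.I)) := by
  obtain ⟨h0, h1⟩ := entries_of_p_eq hg hp
  have hN := normSq_of_p_eq hg hp
  have hrow0 := row_normSq g 0
  have hrow1 := row_normSq g 1
  have hcross := mul_star_entry g 0 1
  rw [h0, Complex.normSq_mul, Complex.normSq_ofReal] at hrow0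
  rw [h1, map_zero, add_zero] at hrow1
  rw [h1, star_zero, mul_zero, add_zero, if_neg (by decide)] at hcross
  have hre := congrArg Complex.re hcross
  have him := congrArg Complex.im hcross
  rw [Complex.add_re, Complex.zero_re] at hre
  rw [Complex.add_im, Complex.zero_im] at him
  have hA : (1 + r ^ 2) ^ 3 * Complex.normSq (g.1 0 0)
      + (1 + r ^ 2) ^ 3 * Complex.normSq (g.1 0 1) = (1 + r ^ 2) ^ 2 := by
    linear_combination (1 + r ^ 2) ^ 3 * hrow0 - (1 + r ^ 2) ^ 2 * r ^ 2 * hN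
  rw [D₁, field_field_eq_hess hH (by decide) Xβ_eq Xmβ_eq hg hp,
    field_field_eq_hess hH (by decide) Xγ_eq Xmγ_eq hg hp, ← smul_add, smul_smul,
    show (-4 : ℂ) * -(1 / 4) = 1 by norm_num, one_smul]
  generalize hess H ((r : ℂ), 0) (1, 0) (1, 0)
    + hess H ((r : ℂ), 0) (Complex.I, 0) (Complex.I, 0) = A
  generalize hess H ((r : ℂ), 0) (0, 1) (0, 1)
    + hess H ((r : ℂ), 0) (0, Complex.I) (0, Complex.I) = B
  generalize hess H ((r : ℂ), 0) (1, 0) (0, 1)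
    + hess H ((r : ℂ), 0) (Complex.I, 0) (0, Complex.I) = C
  generalize hess H ((r : ℂ), 0) (1, 0) (0, Complex.I)
    - hess H ((r : ℂ), 0) (Complex.I, 0) (0, 1) = E
  linear_combination (norm := module) hA • A + ((1 + r ^ 2) * hrow1) • B
    + (2 * (1 + r ^ 2) ^ 2 * hre) • C - (2 * (1 + r ^ 2) ^ 2 * him) • E

/-- The first-order part: `dp(g E_{c2})` and the first row of `A(g)⁻¹` are paired by
`A(g) A(g)⁻¹ = 1`. -/
theorem D₂_of_p_eq (hH : ContDiff ℝ ∞ H) (hg : g ∈ 𝒜) (hp : p g = ((r : ℂ), 0)) :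
    D₂ n (fun x => H (p x)) g
      = (-4 * r : ℂ) • ((1 + (r : ℂ) ^ 2) • (wirt H ((r : ℂ), 0) (1, 0) * dRep n ℓ !![1, 0; 0, 0])
        + wirt H ((r : ℂ), 0) (0, 1) * dRep n ℓ !![0, 1; 0, 0]) := by
  obtain ⟨h0, h1⟩ := entries_of_p_eq hg hp
  have hne := entry_ne_zero hg
  have hdet := det_block_ne_zero hg
  have hu : IsUnit (Φ n ℓ g).det := (Matrix.isUnit_iff_isUnit_det _).1 (isUnit_Φ n ℓ hg)
  set d := (block g.1).det with hd
  have hd' : g.1 0 0 * g.1 1 1 - g.1 0 1 * g.1 1 0 = d := by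
    rw [hd, Matrix.det_fin_two]; rfl
  have hinv : (block g.1)⁻¹ = d⁻¹ • !![g.1 1 1, -g.1 0 1; -g.1 1 0, g.1 0 0] := by
    rw [Matrix.inv_def, Matrix.adjugate_fin_two, Ring.inverse_eq_inv']; rfl
  have hw : ∀ a b : ℂ, wirt H ((r : ℂ), 0) (a, b)
      = a • wirt H ((r : ℂ), 0) (1, 0) + b • wirt H ((r : ℂ), 0) (0, 1) := by
    intro a b
    rw [← wirt_smul, ← wirt_smul, ← wirt_add]
    congr 1
    ext <;> simp
  have hr : ∀ x y : ℂ, dRep n ℓ !![x, y; 0, 0]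
      = x • dRep n ℓ !![1, 0; 0, 0] + y • dRep n ℓ !![0, 1; 0, 0] := by
    intro x y
    rw [← map_smul (dRep n ℓ), ← map_smul (dRep n ℓ), ← map_add]
    congr 1
    ext i j
    fin_cases i <;> fin_cases j <;> simp
  have hβ : block (g.1 * Xmβ.1) * (block g.1)⁻¹
      = !![-(r * g.1 2 2 * g.1 1 0 / d), r * g.1 2 2 * g.1 0 0 / d; 0, 0] := by
    rw [hinv]
    ext i j
    fin_cases i <;> fin_cases j <;>
      simp [block, Xmβ, Matrix.mul_apply, Fin.sum_univ_three, Fin.sum_univ_two, h0, h1] <;> ring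
  have hγ : block (g.1 * Xmγ.1) * (block g.1)⁻¹
      = !![r * g.1 2 2 * g.1 1 1 / d, -(r * g.1 2 2 * g.1 0 1 / d); 0, 0] := by
    rw [hinv]
    ext i j
    fin_cases i <;> fin_cases j <;>
      simp [block, Xmγ, Matrix.mul_apply, Fin.sum_univ_three, Fin.sum_univ_two, h0, h1] <;> ring
  rw [D₂, field_comp_p hH (by decide) Xβ_eq hg, field_comp_p hH (by decide) Xγ_eq hg,
    field_Φ_right n ℓ Xmβ hg, field_Φ_right n ℓ Xmγ hg, mul_assoc, mul_assoc, mul_assoc, mul_assoc,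
    Matrix.mul_nonsing_inv _ hu, mul_one, mul_one, hβ, hγ, hp,
    slope_of_p_eq hg hp (by decide), slope_of_p_eq hg hp (by decide), hw, hw ((1 + _) * _ / _), hr,
    hr (r * g.1 2 2 * g.1 1 1 / d)]
  generalize wirt H ((r : ℂ), 0) (1, 0) = A
  generalize wirt H ((r : ℂ), 0) (0, 1) = B
  generalize dRep n ℓ !![1, 0; 0, 0] = P
  generalize dRep n ℓ !![0, 1; 0, 0] = Q
  have e1 : g.1 2 2 / g.1 2 2 = 1 := div_self hne
  simp only [add_mul, mul_add, smul_mul_smul_comm]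
  have c1 : (1 + (r : ℂ) ^ 2) * g.1 0 1 / g.1 2 2 * -(r * g.1 2 2 * g.1 1 0 / d)
      + (1 + (r : ℂ) ^ 2) * g.1 0 0 / g.1 2 2 * (r * g.1 2 2 * g.1 1 1 / d)
      = r * (1 + (r : ℂ) ^ 2) := by
    field_simp
    linear_combination (1 + (r : ℂ) ^ 2) * r * hd'
  have c2 : (1 + (r : ℂ) ^ 2) * g.1 0 1 / g.1 2 2 * (r * g.1 2 2 * g.1 0 0 / d)
      + (1 + (r : ℂ) ^ 2) * g.1 0 0 / g.1 2 2 * -(r * g.1 2 2 * g.1 0 1 / d) = 0 := by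
    field_simp
    ring
  have c3 : g.1 1 1 / g.1 2 2 * -(r * g.1 2 2 * g.1 1 0 / d)
      + g.1 1 0 / g.1 2 2 * (r * g.1 2 2 * g.1 1 1 / d) = 0 := by
    field_simp
    ring
  have c4 : g.1 1 1 / g.1 2 2 * (r * g.1 2 2 * g.1 0 0 / d)
      + g.1 1 0 / g.1 2 2 * -(r * g.1 2 2 * g.1 0 1 / d) = r := by
    field_simp
    linear_combination r * hd'
  linear_combination (norm := module) (-4 : ℂ) • (c1 • (A * P) + c2 • (A * Q) + c3 • (B * P)
    + c4 • (B * Q))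

/-- On the first axis the two mixed terms of `D₂` reduce to `[π̇(X_{-α}), H] π̇(X_α)`, because
`T - J = 2 X_{-α}`. -/
theorem D_of_p_eq (hH : ContDiff ℝ ∞ H) (hE : Equivariant n H) (hr : 0 < r) (hg : g ∈ 𝒜)
    (hp : p g = ((r : ℂ), 0)) :
    D n (fun x => H (p x)) g = Dtilde n (radial H) r := by
  have hr0 : r ≠ 0 := hr.ne'
  have hw1 : (1 : ℂ) * star 1 = 1 := by simp
  have hwI : Complex.I * star Complex.I = 1 := by simp
  have hJ : dRep n ℓ !![0, -star 1; 1, 0] = -dRep n ℓ !![0, 1; -1, 0] := by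
    rw [← map_neg]; congr 1; ext i j; fin_cases i <;> fin_cases j <;> simp
  have hT : dRep n ℓ !![0, -star Complex.I; Complex.I, 0]
      = Complex.I • dRep n ℓ !![0, 1; 1, 0] := by
    rw [← map_smul]; congr 1; ext i j; fin_cases i <;> fin_cases j <;> simp
  have hY : dRep n ℓ !![0, 0; 1, 0]
      = (1 / 2 : ℂ) • (dRep n ℓ !![0, 1; 1, 0] - dRep n ℓ !![0, 1; -1, 0]) := by
    rw [← map_sub, ← map_smul]; congr 1; ext i j; fin_cases i <;> fin_cases j <;> norm_num
  have d2 := smul_dirDeriv_rot hH hE hw1 r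
  have d3 := smul_dirDeriv_rot hH hE hwI r
  have h2 := smul_hess_rot hH hE hw1 r
  have h3 := smul_hess_rot hH hE hwI r
  rw [hJ] at d2 h2
  rw [hT] at d3 h3
  have hcomm := commute_dRep_diag_deriv hH hE r 1 0
  rw [D, D₁_of_p_eq hH hg hp, D₂_of_p_eq hH hg hp]
  simp only [Dtilde, drep_eq]
  rw [hY, deriv_deriv_radial hH, hess_I_axis hH hE hr0, wirt, wirt,
    show Complex.I • ((1, 0) : ℂ × ℂ) = (Complex.I, 0) by simp,
    show Complex.I • ((0, 1) : ℂ × ℂ) = (0, Complex.I) by simp,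
    dirDeriv_I_axis hH hE hr0]
  have hd1 : dirDeriv H ((r : ℂ), 0) (1, 0) = deriv (radial H) r := by rw [deriv_radial hH]
  rw [hd1]
  have e2 := congrArg (· * dRep n ℓ !![0, 1; 0, 0]) d2
  have e3 := congrArg (· * dRep n ℓ !![0, 1; 0, 0]) d3
  have hreal : ∀ (c : ℝ) (A : EndV ℓ), c • A = (c : ℂ) • A := by
    intro c A; ext i j; simp
  beta_reduce at e2 e3
  generalize dRep n ℓ !![0, 1; 0, 0] = X at *
  generalize dRep n ℓ !![0, 1; -1, 0] = J at *
  generalize dRep n ℓ !![0, 1; 1, 0] = T at *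
  generalize dRep n ℓ !![1, 0; 0, 0] = E at *
  generalize deriv (radial H) r = V at *
  generalize radial H r = U at *
  generalize hess H ((r : ℂ), 0) (1, 0) (1, 0) = A at *
  generalize hess H ((r : ℂ), 0) (0, 1) (0, 1) = B at *
  generalize hess H ((r : ℂ), 0) (0, Complex.I) (0, Complex.I) = C at *
  generalize dirDeriv H ((r : ℂ), 0) (0, 1) = d at *
  generalize dirDeriv H ((r : ℂ), 0) (0, Complex.I) = d' at *
  simp only [pow_two, mul_add, add_mul, mul_sub, sub_mul, smul_mul_assoc, mul_smul_comm, mul_neg,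
    neg_mul, neg_neg, smul_smul, Complex.I_mul_I, smul_add, smul_sub, mul_assoc, hreal, one_mul,
    smul_zero, sub_zero] at h2 h3 e2 e3 hcomm ⊢
  have hrC : (r : ℂ) ≠ 0 := by exact_mod_cast hr0
  push_cast at h2 h3 ⊢
  linear_combination (norm := (match_scalars <;> field_simp <;> ring))
    ((1 + (r : ℂ) ^ 2) / (r : ℂ) ^ 2) • h2 + ((1 + (r : ℂ) ^ 2) / (r : ℂ) ^ 2) • h3
    - (2 : ℂ) • e2 + (2 * Complex.I) • e3 + (2 * r * (1 + (r : ℂ) ^ 2)) • hcomm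
    + (2 * Complex.I_mul_I) • (T * (U * X) - U * (T * X))

end AxisPoint

/-! ### Weight bases -/

theorem ext0_natCast {ℓ : ℕ} {E : Type} [Zero E] (f : Fin (ℓ + 1) → E) {j : ℕ} (hj : j < ℓ + 1) :
    ext0 f (j : ℤ) = f ⟨j, hj⟩ := by
  rw [ext0, dif_pos ⟨by omega, by omega⟩]
  simp

theorem ext0_eq_zero {ℓ : ℕ} {E : Type} [Zero E] (f : Fin (ℓ + 1) → E) {k : ℤ}
    (hk : ¬ (0 ≤ k ∧ k ≤ ℓ)) : ext0 f k = 0 := dif_neg hk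

/-- The lower neighbour of an index: either the index is `0`, or it is `j + 1` and the extension by
zero is evaluated at `j`. -/
theorem ext0_pred {ℓ : ℕ} {E : Type} [Zero E] (f : Fin (ℓ + 1) → E) (i : Fin (ℓ + 1)) :
    ((i : ℕ) = 0 ∧ ext0 f ((i : ℕ) - 1 : ℤ) = 0) ∨
      ∃ j : Fin (ℓ + 1), (i : ℕ) = j + 1 ∧ ext0 f ((i : ℕ) - 1 : ℤ) = f j := by
  have hi := i.2
  rcases Nat.eq_zero_or_pos (i : ℕ) with h | h
  · exact Or.inl ⟨h, ext0_eq_zero f (by omega)⟩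
  · refine Or.inr ⟨⟨i - 1, by omega⟩, by simp; omega, ?_⟩
    rw [← ext0_natCast f (by omega)]
    congr 1
    omega

theorem ext0_succ {ℓ : ℕ} {E : Type} [Zero E] (f : Fin (ℓ + 1) → E) (i : Fin (ℓ + 1)) :
    ((i : ℕ) = ℓ ∧ ext0 f ((i : ℕ) + 1 : ℤ) = 0) ∨
      ∃ j : Fin (ℓ + 1), (j : ℕ) = i + 1 ∧ ext0 f ((i : ℕ) + 1 : ℤ) = f j := by
  have hi := i.2
  rcases Nat.lt_or_ge (i : ℕ) ℓ with h | h
  · refine Or.inr ⟨⟨i + 1, by omega⟩, rfl, ?_⟩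
    rw [← ext0_natCast f (by omega)]
    congr 1
  · exact Or.inl ⟨by omega, ext0_eq_zero f (by omega)⟩

theorem choose_cast_ne_zero {ℓ : ℕ} (i : Fin (ℓ + 1)) : ((ℓ.choose i : ℕ) : ℂ) ≠ 0 :=
  Nat.cast_ne_zero.2 (Nat.choose_pos (by omega)).ne'

theorem choose_succ_cast {ℓ j : ℕ} (hj : j ≤ ℓ) :
    (ℓ.choose (j + 1) : ℂ) * (j + 1) = ℓ.choose j * (ℓ - j) := by
  have h := Nat.choose_succ_right_eq ℓ j
  have h2 := congrArg (Nat.cast : ℕ → ℂ) h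
  push_cast [Nat.cast_sub hj] at h2
  exact h2

/-- The basis `v_i = (ℓ choose i) e₁^(ℓ-i) e₂^i`. -/
def stdWeightBasis (ℓ : ℕ) : Module.Basis (Fin (ℓ + 1)) ℂ (Fin (ℓ + 1) → ℂ) :=
  (Pi.basisFun ℂ (Fin (ℓ + 1))).isUnitSMul (w := fun i => ((ℓ.choose i : ℕ) : ℂ))
    fun i => isUnit_iff_ne_zero.2 (choose_cast_ne_zero i)

theorem stdWeightBasis_apply (ℓ : ℕ) (i k : Fin (ℓ + 1)) :
    stdWeightBasis ℓ i k = if (k : ℕ) = i then ((ℓ.choose i : ℕ) : ℂ) else 0 := by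
  rw [stdWeightBasis, Module.Basis.isUnitSMul_apply, Pi.basisFun_apply, Pi.smul_apply,
    Pi.single_apply, smul_eq_mul, mul_ite, mul_one, mul_zero]
  simp only [Fin.ext_iff]

theorem dRep_mulVec_stdWeightBasis (n : ℤ) (ℓ : ℕ) (Y : Matrix (Fin 2) (Fin 2) ℂ)
    (i k : Fin (ℓ + 1)) :
    (dRep n ℓ Y *ᵥ stdWeightBasis ℓ i) k = dRep n ℓ Y k i * ((ℓ.choose i : ℕ) : ℂ) := by
  rw [stdWeightBasis, Module.Basis.isUnitSMul_apply, Pi.basisFun_apply, Matrix.mulVec_smul,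
    Matrix.mulVec_single_one, Pi.smul_apply, Matrix.col_apply, smul_eq_mul, mul_comm]

theorem isWeightBasis_std (n : ℤ) (ℓ : ℕ) : IsWeightBasis n (stdWeightBasis ℓ) := by
  intro i
  have hi := i.2
  refine ⟨?_, ?_, ?_, ?_⟩ <;> ext k <;>
    rw [drep_eq, dRep_mulVec_stdWeightBasis, dRep_apply, Pi.smul_apply, smul_eq_mul]
  · rw [stdWeightBasis_apply]
    split_ifs <;> simp <;> (left; ring)
  · rcases ext0_pred (stdWeightBasis ℓ) i with ⟨h, h'⟩ | ⟨j, h, h'⟩ <;> rw [h']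
    · simp [h]
    · have hc := choose_succ_cast (show (j : ℕ) ≤ ℓ by omega)
      rw [stdWeightBasis_apply, h]
      by_cases hk : (k : ℕ) = j
      · simp [hk]; linear_combination hc
      · simp [hk]
  · rcases ext0_succ (stdWeightBasis ℓ) i with ⟨h, h'⟩ | ⟨j, h, h'⟩ <;> rw [h']
    · simp [h]
    · have hc := choose_succ_cast (show (i : ℕ) ≤ ℓ by omega)
      rw [stdWeightBasis_apply, h]
      by_cases hk : (k : ℕ) = i + 1
      · simp [hk]; linear_combination -hc
      · simp [hk]
  · rw [stdWeightBasis_apply]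
    split_ifs <;> simp <;> (left; ring)

section Basis

variable {ℓ : ℕ} (v : Module.Basis (Fin (ℓ + 1)) ℂ (Fin (ℓ + 1) → ℂ))

theorem matrix_eq_of_basis {A B : EndV ℓ} (h : ∀ i, A *ᵥ v i = B *ᵥ v i) : A = B :=
  Matrix.toLin'.injective (v.ext fun i => by simpa using h i)

theorem toMatrix'_constr_mulVec (c : Fin (ℓ + 1) → ℂ) (i : Fin (ℓ + 1)) :
    LinearMap.toMatrix' (v.constr ℂ fun j => c j • v j) *ᵥ v i = c i • v i := by
  rw [LinearMap.toMatrix'_mulVec, v.constr_basis]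

/-- The matrix with eigenvalues `c` in the basis `v`. -/
def diagMat : (Fin (ℓ + 1) → ℂ) →ₗ[ℂ] EndV ℓ where
  toFun c := LinearMap.toMatrix' (v.constr ℂ fun j => c j • v j)
  map_add' c d := by
    refine matrix_eq_of_basis v fun i => ?_
    rw [Matrix.add_mulVec]
    rw [toMatrix'_constr_mulVec, toMatrix'_constr_mulVec, toMatrix'_constr_mulVec, Pi.add_apply,
      add_smul]
  map_smul' a c := by
    refine matrix_eq_of_basis v fun i => ?_
    rw [toMatrix'_constr_mulVec, RingHom.id_apply, Matrix.smul_mulVec, toMatrix'_constr_mulVec,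
      Pi.smul_apply, smul_eq_mul, mul_smul]

theorem diagMat_mulVec (c : Fin (ℓ + 1) → ℂ) (i : Fin (ℓ + 1)) :
    diagMat v c *ᵥ v i = c i • v i := toMatrix'_constr_mulVec v c i

theorem hasDerivAt_diagMat {c : Fin (ℓ + 1) → ℝ → ℂ} {c' : Fin (ℓ + 1) → ℂ} {r : ℝ}
    (h : ∀ i, HasDerivAt (c i) (c' i) r) :
    HasDerivAt (fun s => diagMat v fun i => c i s) (diagMat v c') r := by
  have h1 : HasDerivAt (fun s i => c i s) c' r := hasDerivAt_pi.2 h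
  exact ((LinearMap.toContinuousLinearMap (diagMat v)).restrictScalars ℝ).hasFDerivAt.comp_hasDerivAt
    r h1

variable {v}

/-- Commuting with the simple spectrum of `π̇(H_α)` forces a matrix to be diagonal. -/
theorem mulVec_eq_of_commute {n : ℤ} (hv : IsWeightBasis n v) {M : EndV ℓ}
    (hM : drep n ℓ !![1, 0; 0, -1] * M = M * drep n ℓ !![1, 0; 0, -1]) (i : Fin (ℓ + 1)) :
    M *ᵥ v i = v.repr (M *ᵥ v i) i • v i := by
  have hdiag : drep n ℓ !![1, 0; 0, -1] = diagMat v fun j => (ℓ : ℂ) - 2 * (j : ℕ) :=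
    matrix_eq_of_basis v fun j => by rw [diagMat_mulVec, (hv j).1]
  have hrepr : ∀ (x : Fin (ℓ + 1) → ℂ) (j : Fin (ℓ + 1)),
      v.repr (drep n ℓ !![1, 0; 0, -1] *ᵥ x) j = ((ℓ : ℂ) - 2 * (j : ℕ)) * v.repr x j := by
    intro x j
    conv_lhs => rw [← v.sum_repr x, Matrix.mulVec_sum]
    simp only [Matrix.mulVec_smul, (hv _).1, map_sum, map_smul, Module.Basis.repr_self,
      Finsupp.coe_finsetSum, Finset.sum_apply, Finsupp.smul_apply, Finsupp.single_apply,
      smul_eq_mul]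
    rw [Finset.sum_eq_single j]
    · simp; ring
    · intro k _ hk; simp [hk]
    · simp
  have h0 : ∀ j, j ≠ i → v.repr (M *ᵥ v i) j = 0 := by
    intro j hj
    have h1 := hrepr (M *ᵥ v i) j
    rw [Matrix.mulVec_mulVec, hM, ← Matrix.mulVec_mulVec, (hv i).1, Matrix.mulVec_smul, map_smul,
      Finsupp.smul_apply, smul_eq_mul] at h1
    have h2 : (2 * ((j : ℕ) : ℂ) - 2 * ((i : ℕ) : ℂ)) * v.repr (M *ᵥ v i) j = 0 := by
      linear_combination h1
    refine (mul_eq_zero.1 h2).resolve_left fun h => hj ?_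
    have h3 : ((j : ℕ) : ℂ) = ((i : ℕ) : ℂ) := by linear_combination h / 2
    exact Fin.ext (Nat.cast_injective h3)
  conv_lhs => rw [← v.sum_repr (M *ᵥ v i)]
  rw [Finset.sum_eq_single i]
  · intro j _ hj; rw [h0 j hj, zero_smul]
  · simp

theorem exists_diagonal {n : ℤ} (hv : IsWeightBasis n v) {H : ℂ × ℂ → EndV ℓ}
    (hH : ContDiff ℝ ∞ H) (hE : Equivariant n H) :
    ∃ h : Fin (ℓ + 1) → ℝ → ℂ, (∀ i, ContDiffOn ℝ ∞ (h i) (Set.Ioi 0)) ∧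
      ∀ r : ℝ, 0 < r → ∀ i, radial H r *ᵥ v i = h i r • v i := by
  refine ⟨fun i r => v.repr (radial H r *ᵥ v i) i, fun i => ?_, fun r _ i => ?_⟩
  · let L : EndV ℓ →ₗ[ℂ] ℂ :=
      { toFun := fun A => v.repr (A *ᵥ v i) i
        map_add' := fun A B => by simp [Matrix.add_mulVec]
        map_smul' := fun c A => by simp [Matrix.smul_mulVec] }
    have hrad : ContDiff ℝ ∞ (radial H) :=
      hH.comp (Complex.ofRealCLM.contDiff.prodMk contDiff_const)
    exact (((LinearMap.toContinuousLinearMap L).restrictScalars ℝ).contDiff.comp hrad).contDiffOn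
  · refine mulVec_eq_of_commute hv ?_ i
    rw [drep_eq]
    exact commute_dRep_diag hH hE r 1 (-1)

end Basis

/-! ### The scalar system -/

/-- With `J = X_α - X_{-α}` and `T = X_α + X_{-α}`, the squares of `X_α` and `X_{-α}` cancel in the
difference of the two double commutators. -/
theorem Dtilde_eq (n : ℤ) {ℓ : ℕ} (F : ℝ → EndV ℓ) (r : ℝ) {X Y E : EndV ℓ}
    (hX : drep n ℓ !![0, 1; 0, 0] = X) (hY : drep n ℓ !![0, 0; 1, 0] = Y)
    (hE : drep n ℓ !![1, 0; 0, 0] = E) :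
    Dtilde n F r = ((1 + (r : ℂ) ^ 2) ^ 2) • deriv (deriv F) r
      + ((1 + (r : ℂ) ^ 2) / r) • ((3 + (r : ℂ) ^ 2) • deriv F r
        - (2 * (r : ℂ) ^ 2) • (E * deriv F r))
      + ((1 + (r : ℂ) ^ 2) / (r : ℂ) ^ 2) • ((4 : ℂ) • (X * (F r * Y) + Y * (F r * X))
        - (2 : ℂ) • (X * (Y * F r) + Y * (X * F r) + F r * (X * Y) + F r * (Y * X)))
      - (4 : ℂ) • (Y * (F r * X)) + (4 : ℂ) • (F r * (Y * X)) := by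
  have hJ : drep n ℓ !![0, 1; -1, 0] = X - Y := by
    rw [← hX, ← hY, drep_eq, drep_eq, drep_eq, ← map_sub]
    congr 1; ext i j; fin_cases i <;> fin_cases j <;> simp
  have hT : drep n ℓ !![0, 1; 1, 0] = X + Y := by
    rw [← hX, ← hY, drep_eq, drep_eq, drep_eq, ← map_add]
    congr 1; ext i j; fin_cases i <;> fin_cases j <;> simp
  have hreal : ∀ (c : ℝ) (A : EndV ℓ), c • A = (c : ℂ) • A := by
    intro c A; ext i j; simp
  simp only [Dtilde, hJ, hT, hX, hY, hE]
  generalize deriv (deriv F) r = W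
  generalize deriv F r = V
  generalize F r = U
  simp only [pow_two (_ : EndV ℓ), mul_add, add_mul, mul_sub, sub_mul, smul_mul_assoc,
    mul_assoc, hreal, one_mul]
  push_cast
  module

/-- The extension by zero makes the eigenvector equation hold at all integer indices. -/
theorem mulVec_ext0 {ℓ : ℕ} {v : Module.Basis (Fin (ℓ + 1)) ℂ (Fin (ℓ + 1) → ℂ)} {U : EndV ℓ}
    {h : Fin (ℓ + 1) → ℝ → ℂ} {r : ℝ} (hU : ∀ i, U *ᵥ v i = h i r • v i) (k : ℤ) :
    U *ᵥ ext0 v k = ext0 h k r • ext0 v k := by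
  by_cases hk : 0 ≤ k ∧ k ≤ ℓ
  · simp only [ext0, dif_pos hk, hU]
  · simp [ext0_eq_zero _ hk]

/-- The value of `D̃` on a function that is diagonal in a weight basis at `r`, to second order. -/
theorem Dtilde_mulVec {n : ℤ} {ℓ : ℕ} {v : Module.Basis (Fin (ℓ + 1)) ℂ (Fin (ℓ + 1) → ℂ)}
    (hv : IsWeightBasis n v) {F : ℝ → EndV ℓ} {h : Fin (ℓ + 1) → ℝ → ℂ} {r : ℝ}
    (h0 : ∀ i, F r *ᵥ v i = h i r • v i) (h1 : ∀ i, deriv F r *ᵥ v i = deriv (h i) r • v i)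
    (h2 : ∀ i, deriv (deriv F) r *ᵥ v i = deriv (deriv (h i)) r • v i) (i : Fin (ℓ + 1)) :
    Dtilde n F r *ᵥ v i = systemLHS n h i r • v i := by
  have hE : drep n ℓ !![1, 0; 0, 0] *ᵥ v i = ((n : ℂ) + ℓ - (i : ℕ)) • v i := by
    have : drep n ℓ !![1, 0; 0, 0] = (1 / 2 : ℂ) • (drep n ℓ !![1, 0; 0, -1]
        + drep n ℓ !![1, 0; 0, 1]) := by
      rw [drep_eq, drep_eq, drep_eq, ← map_add, ← map_smul]
      congr 1; ext i j; fin_cases i <;> fin_cases j <;> norm_num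
    rw [this, Matrix.smul_mulVec, Matrix.add_mulVec, (hv i).1, (hv i).2.2.2]
    module
  -- for `i = 0` both sides vanish, although `ext0 v (-1)` is not a basis vector
  have hYX : drep n ℓ !![0, 0; 1, 0] *ᵥ ext0 v ((i : ℕ) - 1 : ℤ) = ((i : ℕ) : ℂ) • v i := by
    rcases ext0_pred v i with ⟨h, h'⟩ | ⟨j, h, h'⟩ <;> rw [h']
    · simp [h]
    · rw [(hv j).2.2.1, show ((j : ℕ) + 1 : ℤ) = ((i : ℕ) : ℤ) by omega, ext0_natCast v i.2,
        show ((i : ℕ) : ℂ) = (j : ℕ) + 1 by rw [h]; push_cast; rfl]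
  have hXY : drep n ℓ !![0, 1; 0, 0] *ᵥ ext0 v ((i : ℕ) + 1 : ℤ)
      = ((ℓ : ℂ) - (i : ℕ)) • v i := by
    rcases ext0_succ v i with ⟨h, h'⟩ | ⟨j, h, h'⟩ <;> rw [h']
    · simp [h]
    · rw [(hv j).2.1, show ((j : ℕ) - 1 : ℤ) = ((i : ℕ) : ℤ) by omega, ext0_natCast v i.2, h]
      push_cast
      congr 1
      ring
  rw [Dtilde_eq n F r rfl rfl rfl]
  simp only [Matrix.add_mulVec, Matrix.sub_mulVec, Matrix.smul_mulVec, ← Matrix.mulVec_mulVec,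
    h0, h1, h2, Matrix.mulVec_smul, (hv i).2.1, (hv i).2.2.1, mulVec_ext0 h0, hE, hYX, hXY,
    systemLHS]
  module

theorem Dtilde_diagonal {n : ℤ} {ℓ : ℕ} {v : Module.Basis (Fin (ℓ + 1)) ℂ (Fin (ℓ + 1) → ℂ)}
    (hv : IsWeightBasis n v) {F : ℝ → EndV ℓ} {h : Fin (ℓ + 1) → ℝ → ℂ}
    (hh : ∀ i, ContDiffOn ℝ 2 (h i) (Set.Ioi 0))
    (hF : ∀ r : ℝ, 0 < r → ∀ i, F r *ᵥ v i = h i r • v i) {r : ℝ} (hr : 0 < r)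
    (i : Fin (ℓ + 1)) : Dtilde n F r *ᵥ v i = systemLHS n h i r • v i := by
  have hnhds : ∀ s : ℝ, 0 < s → Set.Ioi (0 : ℝ) ∈ nhds s := fun s hs => Ioi_mem_nhds hs
  have hFd : ∀ s : ℝ, 0 < s → F s = diagMat v fun i => h i s := fun s hs =>
    matrix_eq_of_basis v fun i => by rw [hF s hs, diagMat_mulVec]
  have hd1 : ∀ i, DifferentiableOn ℝ (h i) (Set.Ioi 0) := fun i =>
    (hh i).differentiableOn (by simp)
  have hd2 : ∀ i, DifferentiableOn ℝ (deriv (h i)) (Set.Ioi 0) := fun i =>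
    ((hh i).deriv_of_isOpen (m := 1) isOpen_Ioi (by norm_num)).differentiableOn (by simp)
  have hF1 : ∀ s : ℝ, 0 < s → deriv F s = diagMat v fun i => deriv (h i) s := by
    intro s hs
    refine HasDerivAt.deriv ((hasDerivAt_diagMat v fun i =>
      ((hd1 i s hs).differentiableAt (hnhds s hs)).hasDerivAt).congr_of_eventuallyEq ?_)
    exact Filter.mem_of_superset (hnhds s hs) fun t ht => hFd t ht
  have hF2 : deriv (deriv F) r = diagMat v fun i => deriv (deriv (h i)) r := by
    refine HasDerivAt.deriv ((hasDerivAt_diagMat v fun i =>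
      ((hd2 i r hr).differentiableAt (hnhds r hr)).hasDerivAt).congr_of_eventuallyEq ?_)
    exact Filter.mem_of_superset (hnhds r hr) fun t ht => hF1 t ht
  refine Dtilde_mulVec hv (hF r hr) (fun i => ?_) (fun i => ?_) i
  · rw [hF1 r hr, diagMat_mulVec]
  · rw [hF2, diagMat_mulVec]

theorem Dtilde_eq_smul_iff {n : ℤ} {ℓ : ℕ}
    {v : Module.Basis (Fin (ℓ + 1)) ℂ (Fin (ℓ + 1) → ℂ)}
    (hv : IsWeightBasis n v) {F : ℝ → EndV ℓ} {h : Fin (ℓ + 1) → ℝ → ℂ}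
    (hh : ∀ i, ContDiffOn ℝ 2 (h i) (Set.Ioi 0))
    (hF : ∀ r : ℝ, 0 < r → ∀ i, F r *ᵥ v i = h i r • v i) (lam : ℂ) :
    (∀ r : ℝ, 0 < r → Dtilde n F r = lam • F r) ↔
      (∀ r : ℝ, 0 < r → ∀ i, systemLHS n h i r = lam * h i r) := by
  constructor
  · intro H r hr i
    have h1 := Dtilde_diagonal hv hh hF hr i
    rw [H r hr, Matrix.smul_mulVec, hF r hr, smul_smul] at h1
    exact (smul_left_injective ℂ (v.ne_zero i) h1).symm
  · intro H r hr
    refine matrix_eq_of_basis v fun i => ?_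
    rw [Dtilde_diagonal hv hh hF hr, H r hr, Matrix.smul_mulVec, hF r hr, smul_smul]

end SU3

end

theorem theorem5p1 (n : ℤ) (ℓ : ℕ) :
    -- `Δ₂` acts on `H Φ_π` through the operator `D` on `H`
    (∀ H : ℂ × ℂ → SU3.EndV ℓ, ContDiff ℝ ∞ H → ∀ g ∈ SU3.𝒜,
      SU3.Δ₂ (fun x => H (SU3.p x) * SU3.Φ n ℓ x) g =
        H (SU3.p g) * SU3.Φ n ℓ g * SU3.drepΔ₂K n ℓ
          + SU3.D n (fun x => H (SU3.p x)) g * SU3.Φ n ℓ g) ∧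
    -- `(D H)(r, 0) = (D̃ H̃)(r)`
    (∀ H : ℂ × ℂ → SU3.EndV ℓ, ContDiff ℝ ∞ H → SU3.Equivariant n H →
      ∀ r : ℝ, 0 < r → ∀ g ∈ SU3.𝒜, SU3.p g = ((r : ℂ), 0) →
        SU3.D n (fun x => H (SU3.p x)) g = SU3.Dtilde n (SU3.radial H) r) ∧
    -- bases of the required kind exist
    (∃ v : Module.Basis (Fin (ℓ + 1)) ℂ (Fin (ℓ + 1) → ℂ), SU3.IsWeightBasis n v) ∧
    (∀ v : Module.Basis (Fin (ℓ + 1)) ℂ (Fin (ℓ + 1) → ℂ), SU3.IsWeightBasis n v →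
      -- `H̃` is diagonal in such a basis
      (∀ H : ℂ × ℂ → SU3.EndV ℓ, ContDiff ℝ ∞ H → SU3.Equivariant n H →
        ∃ h : Fin (ℓ + 1) → ℝ → ℂ, (∀ i, ContDiffOn ℝ ∞ (h i) (Set.Ioi 0)) ∧
          ∀ r : ℝ, 0 < r → ∀ i, SU3.radial H r *ᵥ v i = h i r • v i) ∧
      -- for diagonal functions `D̃` is the system for `h₀, …, h_ℓ`
      (∀ (F : ℝ → SU3.EndV ℓ) (h : Fin (ℓ + 1) → ℝ → ℂ),
        (∀ i, ContDiffOn ℝ 2 (h i) (Set.Ioi 0)) →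
        (∀ r : ℝ, 0 < r → ∀ i, F r *ᵥ v i = h i r • v i) →
        (∀ r : ℝ, 0 < r → ∀ i,
          SU3.Dtilde n F r *ᵥ v i = SU3.systemLHS n h i r • v i) ∧
        ∀ lam : ℂ,
          (∀ r : ℝ, 0 < r → SU3.Dtilde n F r = lam • F r) ↔
            (∀ r : ℝ, 0 < r → ∀ i, SU3.systemLHS n h i r = lam * h i r))) := by
  refine ⟨fun H hH g hg => SU3.Δ₂_mul_Φ n hH hg,
    fun H hH hE r hr g hg hp => SU3.D_of_p_eq hH hE hr hg hp,
    ⟨SU3.stdWeightBasis ℓ, SU3.isWeightBasis_std n ℓ⟩, fun v hv => ⟨fun H hH hE =>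
      SU3.exists_diagonal hv hH hE, fun F h hh hF => ⟨fun r hr i =>
        SU3.Dtilde_diagonal hv hh hF hr i, fun lam => SU3.Dtilde_eq_smul_iff hv hh hF lam⟩⟩⟩
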